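/- For a finite alphabet $\Sigma$, equip $\Sigma^\omega$ with the product topology of the discrete topology on $\Sigma$. A Büchi automaton $(K,\Sigma,\delta,q_0,F)$ has a finite set of states $K$, a transition map $\delta:K\times\Sigma\to 2^K$, an initial state $q_0\in K$ and a set $F\subseteq K$; a Muller automaton has a family $\mathcal F\subseteq 2^K$ instead of $F$. A run on $\sigma=a_1a_2\ldots\in\Sigma^\omega$ is a sequence of states $q_1q_2\ldots$ with $q_1=q_0$ and $q_{i+1}\in\delta(q_i,a_i)$ for all $i\ge 1$. The automaton accepts the set $L(\mathcal A)$ of those $\sigma\in\Sigma^\omega$ that have a run for which the set $I$ of states occurring infinitely often satisfies $I\cap F\neq\emptyset$ (Büchi), respectively $I\in\mathcal F$ (Muller). **Theorem (automatic Baire property).** There is an algorithm that, given a finite alphabet $\Sigma$ and a (possibly nondeterministic) Büchi or Muller automaton $\mathcal A$ over $\Sigma$, constructs Büchi automata $\mathcal B$ and $\mathcal C$ over $\Sigma$ such that $L(\mathcal B)$ is an open subset of $\Sigma^\omega$, $L(\mathcal C)$ is a countable union of closed subsets of $\Sigma^\omega$ with empty interior, and $$L(\mathcal A)\,\Delta\,L(\mathcal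 B)\subseteq L(\mathcal C).$$ -/

import Mathlib

namespace OmegaAutomata

/-- A (nondeterministic) finite state machine over the alphabet `α` with state set `K`:
a transition map from `K × α` into the subsets of `K`, and an initial state.
Finiteness of `K` and `α` is imposed where machines are used. -/
structure FSM (α K : Type*) where
  δ : K → α → Set K
  q₀ : K

/-- A Büchi automaton: a finite state machine with a set `F` of final states. -/
structure BuchiAutomaton (α K : Type*) extends FSM α K where
  F : Set K

/-- A Muller automaton: a finite state machine with a collection `𝓕` of designated state sets. -/
structure MullerAutomaton (α K : Type*) extends FSM α K where
  𝓕 : Set (Set K)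

/-- `r` is a run of `M` on the infinite word `x`, starting in the initial state. -/
def FSM.IsRun {α K : Type*} (M : FSM α K) (x : ℕ → α) (r : ℕ → K) : Prop :=
  r 0 = M.q₀ ∧ ∀ i, r (i + 1) ∈ M.δ (r i) (x i)

/-- The set of states entered infinitely many times during `r`. -/
def infStates {K : Type*} (r : ℕ → K) : Set K :=
  {q | {i | r i = q}.Infinite}

/-- The set of infinite words accepted by a Büchi automaton. -/
def BuchiAutomaton.language {α K : Type*} (A : BuchiAutomaton α K) : Set (ℕ → α) :=
  {x | ∃ r, A.IsRun x r ∧ (infStates r ∩ A.F).Nonempty}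

/-- The set of infinite words accepted by a Muller automaton. -/
def MullerAutomaton.language {α K : Type*} (A : MullerAutomaton α K) : Set (ℕ → α) :=
  {x | ∃ r, A.IsRun x r ∧ infStates r ∈ A.𝓕}

/-- A countable union of closed sets with empty interior. -/
def IsMeagerFSigma {X : Type*} [TopologicalSpace X] (S : Set X) : Prop :=
  ∃ T : ℕ → Set X, (∀ n, IsClosed (T n) ∧ interior (T n) = ∅) ∧ S = ⋃ n, T n

/-! ### Finite descriptions of automata, on which algorithms operate

States and letters are numbers: letters are numbered by `e : α ≃ Fin k`, and a description
`(n, i, t)` stands for the machine with states `0, …, n`, initial state `i` (read modulo `n + 1`,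
so that every description is meaningful), and a transition from `q` to `p` on the letter numbered
`a` for each triple `(q, a, p)` of the list `t`. Numbers that are not states or letters are
ignored in lists. -/

/-- Description of a finite state machine: the largest state, the initial state, and the list of
transitions. -/
abbrev FSMCode : Type := ℕ × ℕ × List (ℕ × ℕ × ℕ)

/-- Description of a Büchi automaton: a machine and the list of final states. -/
abbrev BuchiCode : Type := FSMCode × List ℕ

/-- Description of a Muller automaton: a machine and the list of designated state sets. -/
abbrev MullerCode : Type := FSMCode × List (List ℕ)

/-- Description of a Büchi or Muller automaton. -/
abbrev AutomatonCode : Type := BuchiCode ⊕ MullerCode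

def FSMCode.toFSM {α : Type*} {k : ℕ} (e : α ≃ Fin k) (c : FSMCode) : FSM α (Fin (c.1 + 1)) where
  δ q a := {p | ((q : ℕ), (e a : ℕ), (p : ℕ)) ∈ c.2.2}
  q₀ := Fin.ofNat (c.1 + 1) c.2.1

def BuchiCode.toBuchi {α : Type*} {k : ℕ} (e : α ≃ Fin k) (c : BuchiCode) :
    BuchiAutomaton α (Fin (c.1.1 + 1)) where
  toFSM := FSMCode.toFSM e c.1
  F := {q | (q : ℕ) ∈ c.2}

def MullerCode.toMuller {α : Type*} {k : ℕ} (e : α ≃ Fin k) (c : MullerCode) :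
    MullerAutomaton α (Fin (c.1.1 + 1)) where
  toFSM := FSMCode.toFSM e c.1
  𝓕 := {S | ∃ l ∈ c.2, S = {q : Fin (c.1.1 + 1) | (q : ℕ) ∈ l}}

/-- The language accepted by the Büchi automaton described by `c`. -/
def BuchiCode.language {α : Type*} {k : ℕ} (e : α ≃ Fin k) (c : BuchiCode) : Set (ℕ → α) :=
  (BuchiCode.toBuchi e c).language

/-- The language accepted by the Büchi or Muller automaton described by `c`. -/
def AutomatonCode.language {α : Type*} {k : ℕ} (e : α ≃ Fin k) :
    AutomatonCode → Set (ℕ → α)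
  | Sum.inl c => (BuchiCode.toBuchi e c).language
  | Sum.inr c => (MullerCode.toMuller e c).language

/-- Every finite state machine with states `0, …, n` has a description. -/
theorem exists_fsmCode {α : Type*} {k : ℕ} (e : α ≃ Fin k) {n : ℕ} (M : FSM α (Fin (n + 1))) :
    ∃ (i : ℕ) (t : List (ℕ × ℕ × ℕ)), FSMCode.toFSM e (n, i, t) = M := by
  classical
  let T : Finset (Fin (n + 1) × Fin k × Fin (n + 1)) :=
    Finset.univ.filter fun s => s.2.2 ∈ M.δ s.1 (e.symm s.2.1)
  refine ⟨M.q₀, T.toList.map fun s => ((s.1 : ℕ), (s.2.1 : ℕ), (s.2.2 : ℕ)), ?_⟩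
  obtain ⟨δ, q₀⟩ := M
  simp only [FSMCode.toFSM, FSM.mk.injEq]
  refine ⟨?_, by simp⟩
  funext q a
  ext p
  simp only [Set.mem_ofPred_eq, List.mem_map, Finset.mem_toList, Prod.mk.injEq, T,
    Finset.mem_filter, Finset.mem_univ, true_and]
  constructor
  · rintro ⟨⟨q', a', p'⟩, h, h1, h2, h3⟩
    obtain rfl := Fin.ext h1
    obtain rfl := Fin.ext h2
    obtain rfl := Fin.ext h3
    simpa using h
  · intro h
    exact ⟨(q, e a, p), by simpa using h, rfl, rfl, rfl⟩

/-- Every set of states is given by a list. -/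
theorem exists_stateList {n : ℕ} (S : Set (Fin (n + 1))) :
    ∃ l : List ℕ, {q : Fin (n + 1) | (q : ℕ) ∈ l} = S := by
  classical
  refine ⟨(Finset.univ.filter fun q => q ∈ S).toList.map fun q => (q : ℕ), ?_⟩
  ext q
  simp [Fin.val_inj]

/-- Every Büchi automaton with states `0, …, n` has a description. -/
theorem exists_buchiCode {α : Type*} {k : ℕ} (e : α ≃ Fin k) {n : ℕ}
    (A : BuchiAutomaton α (Fin (n + 1))) :
    ∃ (i : ℕ) (t : List (ℕ × ℕ × ℕ)) (l : List ℕ),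
      BuchiCode.toBuchi e ((n, i, t), l) = A := by
  obtain ⟨M, F⟩ := A
  obtain ⟨i, t, h⟩ := exists_fsmCode e M
  obtain ⟨l, hl⟩ := exists_stateList F
  exact ⟨i, t, l, by simp only [BuchiCode.toBuchi, h, hl]⟩

/-- Every Muller automaton with states `0, …, n` has a description. -/
theorem exists_mullerCode {α : Type*} {k : ℕ} (e : α ≃ Fin k) {n : ℕ}
    (A : MullerAutomaton α (Fin (n + 1))) :
    ∃ (i : ℕ) (t : List (ℕ × ℕ × ℕ)) (l : List (List ℕ)),
      MullerCode.toMuller e ((n, i, t), l) = A := by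
  classical
  obtain ⟨M, F⟩ := A
  obtain ⟨i, t, h⟩ := exists_fsmCode e M
  choose g hg using fun S : Set (Fin (n + 1)) => exists_stateList S
  refine ⟨i, t, (Set.toFinite F).toFinset.toList.map g, ?_⟩
  simp only [MullerCode.toMuller, h, MullerAutomaton.mk.injEq, true_and]
  ext S
  simp [hg]

end OmegaAutomata

open OmegaAutomata

/-!
The idea is to decide acceptance of a generic infinite word from a finite prefix, by means of the
finite monoid of *profiles*. The profile of a finite word `u` is the set of triples `(q, I, p)`
such that some path from `q` to `p` on `u` visits exactly the states in `I`. Büchi acceptance is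
treated as Muller acceptance by the sets of states which meet the set of final states.

In a finite monoid `M` there is an idempotent `e` such that `e M e` is a group
(`exists_idempotent_local_group`). Let `z` be a word whose profile is such an `e`. An infinite word
`x` containing `z z` infinitely often can be cut into blocks all of whose finite concatenations
have profile `e` (`FSM.IsLocallyInvertible.exists_blocks`; the pigeonhole principle replaces
Ramsey's theorem here, thanks to invertibility). Hence `x` is accepted if and only if, after some
prefix `u` with `P e = P` for its profile `P`, there is a state `q` reachable on `u` and a
triple `(q, J, q)` in `e` with `J` accepting (`FSM.IsLocallyInvertible.exists_run_iff`).
Invertibility also shows that this condition is passed on to longer prefixes `u'` whose profile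
`P'` satisfies `P' e = P'`.

So `B` accepts the words which have such a prefix, an open set: it follows the profile of the prefix
until the condition holds. And `C` accepts the words avoiding `z z` in the following sense: from
some position on, cut into blocks of the length of `z z`, they have no block equal to `z z`. For a
fixed position this is a closed set with empty interior (`isMeagerFSigma_avoiding`), and every word
outside `C` contains `z z` infinitely often.

The algorithm searches for the descriptions of `B` and `C`, a list of words which represent
all profiles, and `z`, subject to a primitive recursive condition `IsCertificate`, made of bounded
quantifiers over lists which represent profiles. That condition can always be satisfied
(`exists_isCertificate`), and it implies the properties of `B` and `C` over every alphabet with `k`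
letters (`IsCertificate.mem_language_open_iff`, `IsCertificate.language_meager_eq`).
-/

namespace OmegaAutomata

open Set

/-! ### Profiles of words -/

/-- A profile over the state set `K`: a set of triples `(q, I, p)`, read as "there is a path from
`q` to `p` which visits exactly the states in `I` after leaving its starting point". -/
def Profile (K : Type*) : Type _ := Set (K × Set K × K)

namespace Profile

variable {K : Type*}

instance [Finite K] : Finite (Profile K) := inferInstanceAs (Finite (Set (K × Set K × K)))

instance : Membership (K × Set K × K) (Profile K) := inferInstanceAs (Membership _ (Set _))

@[ext] theorem ext {P Q : Profile K} (h : ∀ q I p, (q, I, p) ∈ P ↔ (q, I, p) ∈ Q) : P = Q :=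
  Set.ext fun ⟨q, I, p⟩ => h q I p

/-- Concatenation of paths. -/
instance : Mul (Profile K) :=
  ⟨fun P Q => ({t | ∃ I s J, (t.1, I, s) ∈ P ∧ (s, J, t.2.2) ∈ Q ∧ t.2.1 = I ∪ J} : Set _)⟩

/-- The profile of the empty word: paths which stay at their starting point. -/
instance : One (Profile K) := ⟨({t | t.1 = t.2.2 ∧ t.2.1 = ∅} : Set _)⟩

theorem mem_mul {P Q : Profile K} {q p : K} {I : Set K} :
    (q, I, p) ∈ P * Q ↔ ∃ J s J', (q, J, s) ∈ P ∧ (s, J', p) ∈ Q ∧ I = J ∪ J' :=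
  Iff.rfl

theorem mem_one {q p : K} {I : Set K} : (q, I, p) ∈ (1 : Profile K) ↔ q = p ∧ I = ∅ :=
  Iff.rfl

instance : Monoid (Profile K) where
  mul_assoc P Q R := by
    ext q I p
    simp only [mem_mul]
    constructor
    · rintro ⟨_, s, J', ⟨J₁, s', J₂, h₁, h₂, rfl⟩, h₃, rfl⟩
      exact ⟨J₁, s', J₂ ∪ J', h₁, ⟨J₂, s, J', h₂, h₃, rfl⟩, union_assoc ..⟩
    · rintro ⟨J, s, _, h₁, ⟨J₁, s', J₂, h₂, h₃, rfl⟩, rfl⟩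
      exact ⟨J ∪ J₁, s', J₂, ⟨J, s, J₁, h₁, h₂, rfl⟩, h₃, (union_assoc ..).symm⟩
  one_mul P := by
    ext q I p
    simp only [mem_mul, mem_one]
    constructor
    · rintro ⟨_, _, J, ⟨rfl, rfl⟩, h, rfl⟩
      simpa using h
    · intro h
      exact ⟨∅, q, I, ⟨rfl, rfl⟩, h, by simp⟩
  mul_one P := by
    ext q I p
    simp only [mem_mul, mem_one]
    constructor
    · rintro ⟨J, _, _, h, ⟨rfl, rfl⟩, rfl⟩
      simpa using h
    · intro h
      exact ⟨I, p, ∅, h, ⟨rfl, rfl⟩, by simp⟩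

end Profile

variable {α K : Type*}

/-- The profile of a letter. -/
def FSM.letterProfile (M : FSM α K) (a : α) : Profile K :=
  ({t | t.2.2 ∈ M.δ t.1 a ∧ t.2.1 = {t.2.2}} : Set _)

/-- The profile of a finite word: its triples describe the paths of the machine on this word. -/
def FSM.profile (M : FSM α K) : FreeMonoid α →* Profile K :=
  FreeMonoid.lift M.letterProfile

theorem FSM.mem_profile_of {M : FSM α K} {a : α} {q p : K} {I : Set K} :
    (q, I, p) ∈ M.profile (FreeMonoid.of a) ↔ p ∈ M.δ q a ∧ I = {p} := by
  rw [FSM.profile, FreeMonoid.lift_eval_of]; rfl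

/-- The factor `x m, …, x (n - 1)` of an infinite word; it is empty if `n ≤ m`. -/
def factor (x : ℕ → α) (m n : ℕ) : FreeMonoid α := FreeMonoid.ofList ((List.Ico m n).map x)

theorem length_factor (x : ℕ → α) (m n : ℕ) : (factor x m n).length = n - m := by
  change ((List.Ico m n).map x).length = _
  simp

theorem factor_self (x : ℕ → α) (m : ℕ) : factor x m m = 1 := by
  simp [factor]

theorem factor_mul (x : ℕ → α) {l m n : ℕ} (h : l ≤ m) (h' : m ≤ n) :
    factor x l m * factor x m n = factor x l n := by
  rw [factor, factor, factor, ← List.Ico.append_consecutive h h', List.map_append,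
    FreeMonoid.ofList_append]

theorem factor_succ (x : ℕ → α) {m n : ℕ} (h : m ≤ n) :
    factor x m (n + 1) = factor x m n * FreeMonoid.of (x n) := by
  rw [← factor_mul x h n.le_succ]
  congr 1
  rw [factor, Nat.succ_eq_add_one, List.Ico.succ_singleton]; rfl

/-- The triples in the profile of a factor of `x` correspond to the finite pieces of runs
on `x`. -/
theorem FSM.mem_profile_factor {M : FSM α K} {x : ℕ → α} {m n : ℕ} (hmn : m ≤ n) {q p : K}
    {I : Set K} : (q, I, p) ∈ M.profile (factor x m n) ↔
      ∃ r : ℕ → K, r m = q ∧ r n = p ∧ (∀ i, m ≤ i → i < n → r (i + 1) ∈ M.δ (r i) (x i)) ∧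
        I = r '' Ioc m n := by
  induction n, hmn using Nat.le_induction generalizing p I with
  | base =>
    rw [factor_self, map_one, Profile.mem_one]
    constructor
    · rintro ⟨rfl, rfl⟩
      exact ⟨fun _ => q, rfl, rfl, fun i h h' => by omega, by simp⟩
    · rintro ⟨r, rfl, rfl, -, rfl⟩
      simp
  | succ n hmn ih =>
    have hIoc : Ioc m (n + 1) = Ioc m n ∪ {n + 1} := by
      ext i; simp; omega
    rw [factor_succ x hmn, map_mul, Profile.mem_mul]
    constructor
    · rintro ⟨J, s, J', h₁, h₂, rfl⟩
      obtain ⟨r, rfl, rfl, hr, rfl⟩ := ih.1 h₁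
      obtain ⟨hp, rfl⟩ := FSM.mem_profile_of.1 h₂
      refine ⟨Function.update r (n + 1) p, ?_, by simp, fun i hi hi' => ?_, ?_⟩
      · rw [Function.update_of_ne (by omega)]
      · rcases Nat.lt_succ_iff_lt_or_eq.1 hi' with h | rfl
        · rw [Function.update_of_ne (by omega), Function.update_of_ne (by omega)]
          exact hr i hi h
        · rw [Function.update_self, Function.update_of_ne (by omega)]
          exact hp
      · rw [hIoc, image_union, image_singleton, Function.update_self]
        congr 1
        refine image_congr fun i hi => ?_
        rw [Function.update_of_ne]
        have := hi.2
        omega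
    · rintro ⟨r, rfl, rfl, hr, rfl⟩
      refine ⟨r '' Ioc m n, r n, {r (n + 1)}, ih.2 ⟨r, rfl, rfl, fun i h h' => hr i h (by omega),
        rfl⟩, FSM.mem_profile_of.2 ⟨hr n hmn (by omega), rfl⟩, ?_⟩
      rw [hIoc, image_union, image_singleton]

/-- Finite pieces of runs which fit together can be glued to an infinite run. -/
theorem FSM.exists_run_of_profile {M : FSM α K} {x : ℕ → α} {b : ℕ → ℕ} (hb : StrictMono b)
    (hb0 : b 0 = 0) {s : ℕ → K} {I : ℕ → Set K}
    (h : ∀ i, (s i, I i, s (i + 1)) ∈ M.profile (factor x (b i) (b (i + 1)))) :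
    ∃ r : ℕ → K, r 0 = s 0 ∧ (∀ i, r (i + 1) ∈ M.δ (r i) (x i)) ∧
      ∀ i, r '' Ioc (b i) (b (i + 1)) = I i := by
  choose ρ h₁ h₂ h₃ h₄ using fun i =>
    (FSM.mem_profile_factor (hb (Nat.lt_succ_self i)).le).1 (h i)
  -- position `t` belongs to the block `j t`, counted half-open as `b (j t) ≤ t < b (j t + 1)`
  have hex : ∀ t, ∃ j, t < b (j + 1) := fun t => ⟨t, hb.le_apply⟩
  classical
  let j : ℕ → ℕ := fun t => Nat.find (hex t)
  have hj : ∀ i t, b i ≤ t → t < b (i + 1) → j t = i := by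
    intro i t h h'
    refine (Nat.find_eq_iff _).2 ⟨h', fun n hn hlt => ?_⟩
    have := hb.monotone (Nat.succ_le_of_lt hn)
    simp only [Nat.succ_eq_add_one] at this
    omega
  have hj' : ∀ t, b (j t) ≤ t ∧ t < b (j t + 1) := by
    intro t
    refine ⟨?_, Nat.find_spec (hex t)⟩
    rcases hjt : j t with _ | n
    · omega
    · have := Nat.find_min (hex t) (m := n) (by change n < j t; omega)
      omega
  let r : ℕ → K := fun t => ρ (j t) t
  have hr : ∀ i t, b i ≤ t → t ≤ b (i + 1) → r t = ρ i t := by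
    intro i t h h'
    rcases h'.lt_or_eq with h' | rfl
    · change ρ (j t) t = _
      rw [hj i t h h']
    · change ρ (j _) _ = _
      rw [hj (i + 1) _ le_rfl (hb (Nat.lt_succ_self _)), h₁, h₂]
  refine ⟨r, ?_, fun t => ?_, fun i => ?_⟩
  · rw [hr 0 0 hb0.le (Nat.zero_le _), ← h₁ 0, hb0]
  · obtain ⟨h, h'⟩ := hj' t
    rw [hr (j t) t h h'.le, hr (j t) (t + 1) (by omega) h']
    exact h₃ _ t h h'
  · rw [h₄ i]
    exact image_congr fun t ht => hr i t ht.1.le ht.2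

/-! ### Locally invertible words and generic infinite words -/

/-- The word `z` is idempotent for `M`, and the profiles `e * P * e`, where `e` is the profile
of `z` and `P` is the profile of any word, are invertible relative to `e`. -/
structure FSM.IsLocallyInvertible (M : FSM α K) (z : FreeMonoid α) : Prop where
  idem : M.profile z * M.profile z = M.profile z
  inv : ∀ v, ∃ Y : Profile K,
    M.profile z * M.profile v * M.profile z * Y * M.profile z = M.profile z ∧
    M.profile z * Y * M.profile z * M.profile v * M.profile z = M.profile z

/-- The word `w` occurs infinitely often in `x`. -/
def OccursInfinitelyOften (w : FreeMonoid α) (x : ℕ → α) : Prop :=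
  {n | factor x n (n + w.length) = w}.Infinite

/-- After a prefix with profile `P`, a loop with profile `e` leads to acceptance. -/
def FSM.Accepting (M : FSM α K) (𝓕 : Set (Set K)) (P e : Profile K) : Prop :=
  ∃ q I J, (M.q₀, I, q) ∈ P ∧ (q, J, q) ∈ e ∧ J ∈ 𝓕

/-- An infinite set of positions contains a sequence with gaps of at least `d`, starting at or
after `N`. -/
theorem exists_seq_of_infinite {S : Set ℕ} (hS : S.Infinite) (d N : ℕ) :
    ∃ f : ℕ → ℕ, N ≤ f 0 ∧ (∀ i, f i ∈ S) ∧ ∀ i, f i + d ≤ f (i + 1) := by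
  choose g hg hg' using fun n => hS.exists_gt n
  refine ⟨fun i => Nat.rec (g N) (fun _ m => g (m + d)) i, (hg' N).le, fun i => ?_,
    fun i => (hg' _).le⟩
  cases i <;> exact hg _

/-- An infinite word containing `z * z` infinitely often can be cut, beyond any given position,
into blocks such that any finite concatenation of consecutive blocks has the profile of `z`. -/
theorem FSM.IsLocallyInvertible.exists_blocks [Finite K] {M : FSM α K} {z : FreeMonoid α}
    (hz : M.IsLocallyInvertible z) {x : ℕ → α} (hx : OccursInfinitelyOften (z * z) x) (N : ℕ) :
    ∃ f : ℕ → ℕ, StrictMono f ∧ N ≤ f 0 ∧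
      M.profile (factor x 0 (f 0)) * M.profile z = M.profile (factor x 0 (f 0)) ∧
      (∀ i, M.profile (factor x 0 (f i)) = M.profile (factor x 0 (f 0))) ∧
      ∀ i j, i < j → M.profile (factor x (f i) (f j)) = M.profile z := by
  set l := z.length with hl
  set e := M.profile z with he
  -- occurrences of `z * z` whose middle is reached with the same profile
  obtain ⟨P, hP⟩ : ∃ P, {n | n ∈ {n | factor x n (n + (z * z).length) = z * z} ∧
      M.profile (factor x 0 (n + l)) = P}.Infinite := by
    by_contra! hcon
    refine hx ((Set.finite_iUnion hcon).subset fun n hn => ?_)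
    simp only [mem_iUnion]
    exact ⟨_, hn, rfl⟩
  obtain ⟨g, hgN, hg, hgd⟩ := exists_seq_of_infinite hP (2 * l + 1) N
  have hocc : ∀ i, factor x (g i) (g i + l) = z ∧ factor x (g i + l) (g i + 2 * l) = z := by
    intro i
    have h : factor x (g i) (g i + (z * z).length) = z * z := (hg i).1
    rw [FreeMonoid.length_mul, ← hl, ← factor_mul x (m := g i + l) (by omega) (by omega)] at h
    have h' := List.append_inj (congrArg FreeMonoid.toList h) (by
      change (factor x _ _).length = z.length
      rw [length_factor, ← hl]; omega)
    exact ⟨h'.1, by rw [two_mul]; exact h'.2⟩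
  have hmono : Monotone g := monotone_nat_of_le_succ fun i => by have := hgd i; omega
  have hprof : ∀ i, M.profile (factor x 0 (g i + l)) = P := fun i => (hg i).2
  have hPfac : ∀ i, P = M.profile (factor x 0 (g i)) * e := by
    intro i
    rw [← hprof i, ← factor_mul x (Nat.zero_le (g i)) (by omega), map_mul, (hocc i).1]
  have hPe : P * e = P := by rw [hPfac 0, mul_assoc, hz.idem]
  obtain ⟨Y, -, hY⟩ := hz.inv (factor x 0 (g 0))
  -- `P` has a left inverse relative to `e`, so a profile which stabilizes `P` also stabilizes `e`
  have hYP : e * Y * e * P = e := by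
    rw [hPfac 0, ← mul_assoc]; exact hY
  refine ⟨fun i => g i + l, strictMono_nat_of_lt_succ fun i => by have := hgd i; omega,
    hgN.trans (Nat.le_add_right _ _), by simp only [hprof, hPe], fun i => by simp only [hprof], fun i j hij => ?_⟩
  have hgij : g i + 2 * l ≤ g j := by
    have := hmono (Nat.succ_le_of_lt hij)
    have := hgd i
    simp only [Nat.succ_eq_add_one] at *
    omega
  have hPb : P * M.profile (factor x (g i + l) (g j + l)) = P := by
    conv_lhs => rw [← hprof i]
    rw [← map_mul, factor_mul x (Nat.zero_le _) (by omega), hprof]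
  -- each block starts with the second half of an occurrence of `z * z`
  have heb : e * M.profile (factor x (g i + l) (g j + l)) =
      M.profile (factor x (g i + l) (g j + l)) := by
    rw [← factor_mul x (l := g i + l) (m := g i + 2 * l) (by omega) (by omega), map_mul,
      (hocc i).2, ← mul_assoc, hz.idem]
  rw [← heb]
  conv_lhs => rw [← hYP]
  rw [mul_assoc, hPb, hYP]

/-- If `z` is locally invertible, then on words which contain `z * z` infinitely often,
acceptance is decided by a prefix. -/
theorem FSM.IsLocallyInvertible.exists_run_iff [Finite K] {M : FSM α K} {z : FreeMonoid α}
    (hz : M.IsLocallyInvertible z) {x : ℕ → α} (hx : OccursInfinitelyOften (z * z) x)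
    (𝓕 : Set (Set K)) :
    (∃ r, M.IsRun x r ∧ infStates r ∈ 𝓕) ↔
      ∃ n, M.profile (factor x 0 n) * M.profile z = M.profile (factor x 0 n) ∧
        M.Accepting 𝓕 (M.profile (factor x 0 n)) (M.profile z) := by
  constructor
  · rintro ⟨r, ⟨hr0, hr⟩, hI⟩
    obtain ⟨f, hf, -, hP, hPi, hblock⟩ := hz.exists_blocks hx 0
    refine ⟨f 0, hP, ?_⟩
    -- from position `T` on, only states entered infinitely often are visited
    obtain ⟨T, hT⟩ : ∃ T, ∀ t, T ≤ t → r t ∈ infStates r := by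
      have hfin : (⋃ q ∈ (infStates r)ᶜ, {i | r i = q}).Finite :=
        (Set.toFinite _).biUnion fun q hq => not_infinite.1 hq
      obtain ⟨T, hT⟩ := hfin.bddAbove
      refine ⟨T + 1, fun t ht => by_contra fun hn => ?_⟩
      have := hT (mem_biUnion (x := r t) hn rfl)
      omega
    obtain ⟨q, hq⟩ : ∃ q, {i | r (f i) = q}.Infinite := by
      by_contra! hcon
      refine Set.infinite_univ (α := ℕ) ((Set.finite_iUnion hcon).subset fun n _ => ?_)
      simp
    obtain ⟨i, hi, hiT⟩ := hq.exists_gt T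
    -- between the positions `f i` and `T'` every state in the limit set is visited
    obtain ⟨T', hT'⟩ : ∃ T', ∀ p ∈ infStates r, ∃ t, f i < t ∧ t ≤ T' ∧ r t = p := by
      choose g hg using fun p : infStates r => p.2.exists_gt (f i)
      obtain ⟨T', hT'⟩ := (Set.finite_range g).bddAbove
      exact ⟨T', fun p hp => ⟨g ⟨p, hp⟩, (hg ⟨p, hp⟩).2, hT' (mem_range_self _), (hg ⟨p, hp⟩).1⟩⟩
    obtain ⟨j, hj, hjT⟩ := hq.exists_gt (max i T')
    have hij : i < j := lt_of_le_of_lt (le_max_left ..) hjT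
    have hTi : i ≤ f i := hf.le_apply
    have hTj : j ≤ f j := hf.le_apply
    have hTj' : T' < j := lt_of_le_of_lt (le_max_right ..) hjT
    refine ⟨q, r '' Ioc 0 (f i), infStates r, ?_, ?_, hI⟩
    · rw [← hPi i]
      exact (FSM.mem_profile_factor (Nat.zero_le _)).2 ⟨r, hr0, hi, fun t _ _ => hr t, rfl⟩
    · rw [← hblock i j hij]
      refine (FSM.mem_profile_factor (hf hij).le).2 ⟨r, hi, hj, fun t _ _ => hr t, ?_⟩
      ext p
      constructor
      · intro hp
        obtain ⟨t, h₁, h₂, h₃⟩ := hT' p hp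
        exact ⟨t, ⟨h₁, by omega⟩, h₃⟩
      · rintro ⟨t, ht, rfl⟩
        exact hT t (by have := ht.1; omega)
  · rintro ⟨n, hP, q, I, J, h₁, h₂, hJ⟩
    obtain ⟨f, hf, hf0, hP', hPi, hblock⟩ := hz.exists_blocks hx (n + 1)
    set e := M.profile z with he
    -- transport the loop from position `n` to position `f 0`: as `e = (e V e) (e Y e)`, the loop
    -- at `q` passes through a state `q'` after `e V e`, and since also `e = (e Y e) (e V e)`, it
    -- can be read as a loop at `q'` which visits the same states
    obtain ⟨Y, hY, hY'⟩ := hz.inv (factor x n (f 0))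
    set V := M.profile (factor x n (f 0)) with hV
    have hsplit : M.profile (factor x 0 (f 0)) = M.profile (factor x 0 n) * V := by
      rw [← factor_mul x (Nat.zero_le n) (by omega : n ≤ f 0), map_mul]
    have h₂' : (q, J, q) ∈ (e * V * e) * (e * Y * e) := by
      have : (e * V * e) * (e * Y * e) = e := by
        calc (e * V * e) * (e * Y * e) = e * V * (e * e) * Y * e := by simp only [mul_assoc]
          _ = e := by rw [hz.idem, hY]
      rwa [this]
    obtain ⟨J₁, q', J₂, hq₁, hq₂, rfl⟩ := h₂'
    have hloop : (q', J₂ ∪ J₁, q') ∈ e := by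
      have : (e * Y * e) * (e * V * e) = e := by
        calc (e * Y * e) * (e * V * e) = e * Y * (e * e) * V * e := by simp only [mul_assoc]
          _ = e := by rw [hz.idem, hY']
      rw [← this]
      exact ⟨J₂, q, J₁, hq₂, hq₁, rfl⟩
    have hpre : (M.q₀, I ∪ J₁, q') ∈ M.profile (factor x 0 (f 0)) := by
      have : M.profile (factor x 0 n) * (e * V * e) = M.profile (factor x 0 (f 0)) := by
        rw [← mul_assoc, ← mul_assoc, hP, ← hsplit, hP']
      rw [← this]
      exact ⟨I, q, J₁, h₁, hq₁, rfl⟩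
    rw [union_comm] at hloop
    -- glue a path to `q'` on the prefix with loops at `q'` on the blocks
    obtain ⟨r, hr0, hr, hrI⟩ := FSM.exists_run_of_profile (M := M) (x := x)
      (b := fun i => Nat.casesOn i 0 f) (s := fun i => Nat.casesOn i M.q₀ fun _ => q')
      (I := fun i => Nat.casesOn i (I ∪ J₁) fun _ => J₁ ∪ J₂)
      (strictMono_nat_of_lt_succ fun i => by
        cases i with
        | zero => change 0 < f 0; omega
        | succ i => exact hf (Nat.lt_succ_self i)) rfl
      (fun i => by
        cases i with
        | zero => exact hpre
        | succ i => change _ ∈ M.profile (factor x (f i) (f (i + 1))); rwa [hblock i (i + 1) (by omega)])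
    have hrI' : ∀ i, r '' Ioc (f i) (f (i + 1)) = J₁ ∪ J₂ := fun i => hrI (i + 1)
    refine ⟨r, ⟨hr0, hr⟩, ?_⟩
    convert hJ
    ext p
    constructor
    · intro hp
      obtain ⟨t, ht, ht'⟩ := hp.exists_gt (f 0)
      obtain ⟨i, hi⟩ : ∃ i, t ∈ Ioc (f i) (f (i + 1)) := by
        have hex : ∃ i, t ≤ f (i + 1) := ⟨t, (Nat.le_succ t).trans hf.le_apply⟩
        classical
        refine ⟨Nat.find hex, ?_, Nat.find_spec hex⟩
        rcases hn : Nat.find hex with _ | m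
        · exact ht'
        · have := Nat.find_min hex (m := m) (by omega)
          omega
      rw [← hrI' i]
      exact ⟨t, hi, ht⟩
    · intro hp
      refine Set.infinite_of_not_bddAbove fun ⟨T, hT⟩ => ?_
      rw [← hrI' T] at hp
      obtain ⟨t, ht, ht'⟩ := hp
      have h₁ := hT ht'
      have h₂ : T ≤ f T := hf.le_apply
      have h₃ := ht.1
      omega

/-! ### Existence of locally invertible words -/

theorem exists_pow_idempotent {G : Type*} [Monoid G] [Finite G] (a : G) :
    ∃ n, 0 < n ∧ a ^ n * a ^ n = a ^ n := by
  obtain ⟨i, j, hij, h⟩ := Finite.exists_ne_map_eq_of_infinite (fun n : ℕ => a ^ n)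
  wlog hlt : i < j generalizing i j
  · exact this j i hij.symm h.symm (by omega)
  obtain ⟨d, hd, rfl⟩ : ∃ d, 0 < d ∧ j = i + d := ⟨j - i, by omega, by omega⟩
  have hp : ∀ m s, i ≤ s → a ^ (s + m * d) = a ^ s := by
    intro m s hs
    obtain ⟨c, rfl⟩ := Nat.exists_eq_add_of_le hs
    induction m with
    | zero => simp
    | succ m ih =>
      have : i + c + (m + 1) * d = (i + d) + (c + m * d) := by ring
      rw [this, pow_add, ← (show a ^ i = a ^ (i + d) from h), ← pow_add, ← add_assoc, ih]
  refine ⟨(i + 1) * d, by positivity, ?_⟩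
  rw [← pow_add]
  exact hp (i + 1) _ (by nlinarith)

/-- In a finite monoid there is an idempotent `e` for which `e M e` is a group: any one for which
`e M e` has as few elements as possible. -/
theorem exists_idempotent_local_group (G : Type*) [Monoid G] [Finite G] :
    ∃ e : G, e * e = e ∧ ∀ v, ∃ y, e * v * e * y * e = e ∧ e * y * e * v * e = e := by
  obtain ⟨e, he, hmin⟩ := WellFounded.has_min
    (measure fun e : G => (Set.range fun v => e * v * e).ncard).wf {e | e * e = e}
    ⟨1, mul_one 1⟩
  have he : e * e = e := he
  refine ⟨e, he, fun v => ?_⟩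
  set g := e * v * e with hg
  obtain ⟨n, hn, hidem⟩ := exists_pow_idempotent g
  have heg : e * g = g := by rw [hg, ← mul_assoc, ← mul_assoc, he]
  have hge : g * e = g := by rw [hg, mul_assoc, he]
  obtain ⟨m, rfl⟩ : ∃ m, n = m + 1 := ⟨n - 1, by omega⟩
  have hef : e * g ^ (m + 1) = g ^ (m + 1) := by rw [pow_succ', ← mul_assoc, heg]
  have hfe : g ^ (m + 1) * e = g ^ (m + 1) := by rw [pow_succ, mul_assoc, hge]
  have hsub : (Set.range fun v => g ^ (m + 1) * v * g ^ (m + 1)) ⊆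
      Set.range fun v => e * v * e := by
    rintro _ ⟨u, rfl⟩
    refine ⟨g ^ (m + 1) * u * g ^ (m + 1), ?_⟩
    simp only
    rw [mul_assoc, mul_assoc _ _ e, hfe, ← mul_assoc, ← mul_assoc, hef]
  have heq := Set.eq_of_subset_of_ncard_le hsub (not_lt.1 (hmin _ hidem))
  obtain ⟨u, hu⟩ : e ∈ Set.range fun v => g ^ (m + 1) * v * g ^ (m + 1) := by
    rw [heq]; exact ⟨1, by simp [he]⟩
  have hpow : g ^ (m + 1) = e := by
    have : g ^ (m + 1) * e = e := by
      rw [← hu]; simp only [← mul_assoc, hidem]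
    rw [← this, hfe]
  refine ⟨g ^ m, ?_, ?_⟩
  · rw [← pow_succ', hpow, he]
  · have : e * g ^ m * (e * v * e) = e := by rw [mul_assoc, ← hg, ← pow_succ, hpow, he]
    simpa only [mul_assoc] using this

/-! ### Infinite words avoiding a finite word -/

section Avoiding

variable {α : Type*}

/-- The infinite words `x` for which there is a position, not the first one, from which on `x`,
cut into blocks of the length of `w`, has no block equal to `w`. The first position is excluded
because an automaton with one initial state needs a transition to start reading blocks. If `w` is
empty, there are no such words. -/
def avoiding (w : List α) : Set (ℕ → α) :=
  {x | ∃ N, ∀ j, ∃ c, ∃ h : c < w.length, x (N + 1 + j * w.length + c) ≠ w[c]}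

theorem occursInfinitelyOften_of_notMem_avoiding {w : FreeMonoid α} {x : ℕ → α}
    (hx : x ∉ avoiding (FreeMonoid.toList w)) : OccursInfinitelyOften w x := by
  simp only [avoiding, mem_ofPred_eq, not_exists, not_forall, not_not] at hx
  refine infinite_of_not_bddAbove fun ⟨N, hN⟩ => ?_
  obtain ⟨j, hj⟩ := hx N
  have h := hN (a := N + 1 + j * (FreeMonoid.toList w).length) ?_
  · have := Nat.zero_le (j * (FreeMonoid.toList w).length)
    omega
  · refine FreeMonoid.toList.injective (List.ext_getElem ?_ fun c h₁ h₂ => ?_)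
    · exact (length_factor ..).trans (Nat.add_sub_cancel_left ..)
    · rw [← hj c h₂]
      simp [factor, List.Ico]

theorem isMeagerFSigma_avoiding [TopologicalSpace α] [DiscreteTopology α] (w : List α) :
    IsMeagerFSigma (avoiding w) := by
  refine ⟨fun N => {x | ∀ j, ∃ c, ∃ h : c < w.length, x (N + 1 + j * w.length + c) ≠ w[c]},
    fun N => ⟨?_, ?_⟩, by ext x; simp [avoiding]⟩
  · simp only [ofPred_forall]
    refine isClosed_iInter fun j => ?_
    have : {x : ℕ → α | ∃ c, ∃ h : c < w.length, x (N + 1 + j * w.length + c) ≠ w[c]} =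
        ⋃ c : Fin w.length, (fun x => x (N + 1 + j * w.length + c)) ⁻¹' {w[c]}ᶜ := by
      ext x
      simp only [mem_ofPred_eq, mem_iUnion, mem_preimage, mem_compl_iff, mem_singleton_iff]
      exact ⟨fun ⟨c, h, hc⟩ => ⟨⟨c, h⟩, hc⟩, fun ⟨c, hc⟩ => ⟨c, c.2, hc⟩⟩
    rw [this]
    exact isClosed_iUnion_of_finite fun c =>
      (isClosed_discrete _).preimage (continuous_apply _)
  · refine eq_empty_of_forall_notMem fun x hx => ?_
    obtain ⟨I, u, hu, hsub⟩ := isOpen_pi_iff.1 isOpen_interior x hx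
    obtain ⟨c₀, hc₀, -⟩ := interior_subset hx 0
    obtain ⟨M, hM⟩ := I.bddAbove
    -- insert the word `w` as a block behind all positions controlled by the basic open set
    set s := N + 1 + (M + 1) * w.length with hs
    have hMs : M < s := by
      have : M + 1 ≤ (M + 1) * w.length := Nat.le_mul_of_pos_right _ (by omega)
      omega
    have hy : (fun t => if t < s then x t else w.getD (t - s) (x t)) ∈
        {x : ℕ → α | ∀ j, ∃ c, ∃ h : c < w.length, x (N + 1 + j * w.length + c) ≠ w[c]} := by
      refine interior_subset (hsub fun i hi => ?_)
      have : i < s := (hM hi).trans_lt hMs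
      simp only [this, if_true]
      exact (hu i hi).2
    obtain ⟨c, hc, hne⟩ := hy (M + 1)
    refine hne ?_
    simp [← hs, hc]

end Avoiding

/-! ### An automaton for the avoiding words -/

/-- Transitions of an automaton accepting the words avoiding `w`, where `L` is the length of `w`.
The automaton waits in state `0` and guesses when to start reading blocks. The state `c + 1`
with `c < L` means that the first `c` letters of the current block agree with `w`, and the state
`L + c + 1` with `c < L` that `c` letters of the block are read and one of them differs from `w`.
No transition completes a block equal to `w`. -/
def avoidStep (w : List ℕ) (p a p' : ℕ) : Prop :=
  (p = 0 ∧ p' ≤ 1) ∨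
  (0 < p ∧ p < w.length ∧ a = w.getD (p - 1) 0 ∧ p' = p + 1) ∨
  (0 < p ∧ p < w.length ∧ a ≠ w.getD (p - 1) 0 ∧ p' = w.length + p + 1) ∨
  (0 < p ∧ p = w.length ∧ a ≠ w.getD (p - 1) 0 ∧ p' = 1) ∨
  (w.length < p ∧ p < 2 * w.length ∧ p' = p + 1) ∨
  (w.length < p ∧ p = 2 * w.length ∧ p' = 1)

theorem avoidStep_pos {w : List ℕ} {p a p' : ℕ} (h : avoidStep w p a p') (hp : 0 < p) :
    0 < p' := by
  unfold avoidStep at h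
  omega

/-- Along a block read from state `1`, the state records whether the block still agrees
with `w`. -/
theorem avoidStep_block {w : List ℕ} {x r : ℕ → ℕ}
    (hstep : ∀ t, avoidStep w (r t) (x t) (r (t + 1))) {s : ℕ} (hs : r s = 1) (c : ℕ)
    (hc : c < w.length) :
    (r (s + c) = c + 1 ∧ ∀ d < c, x (s + d) = w.getD d 0) ∨
      (r (s + c) = w.length + c + 1 ∧ ∃ d < c, x (s + d) ≠ w.getD d 0) := by
  induction c with
  | zero => left; exact ⟨hs, fun d hd => absurd hd (Nat.not_lt_zero d)⟩
  | succ c ih =>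
    have h := hstep (s + c)
    rw [add_assoc] at h
    rcases ih (by omega) with ⟨h₁, h₂⟩ | ⟨h₁, d, hd, hne⟩
    · rw [h₁] at h
      by_cases hx : x (s + c) = w.getD c 0
      · refine Or.inl ⟨?_, fun d hd => ?_⟩
        · simp only [avoidStep, Nat.add_sub_cancel] at h
          omega
        · rcases Nat.lt_succ_iff_lt_or_eq.1 hd with h' | rfl
          exacts [h₂ d h', hx]
      · refine Or.inr ⟨?_, c, by omega, hx⟩
        simp only [avoidStep, Nat.add_sub_cancel] at h
        omega
    · refine Or.inr ⟨?_, d, by omega, hne⟩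
      rw [h₁] at h
      unfold avoidStep at h
      omega

theorem exists_avoidRun_iff {w : List ℕ} {x : ℕ → ℕ} :
    (∃ r : ℕ → ℕ, r 0 = 0 ∧ (∀ t, r t ≤ 2 * w.length) ∧
        (∀ t, avoidStep w (r t) (x t) (r (t + 1))) ∧ ∃ t, r t ≠ 0) ↔ x ∈ avoiding w := by
  constructor
  · rintro ⟨r, hr0, hle, hstep, hex⟩
    classical
    obtain ⟨N, hN⟩ : ∃ N, Nat.find hex = N + 1 := by
      refine Nat.exists_eq_succ_of_ne_zero fun h => ?_
      have := Nat.find_spec hex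
      rw [h] at this
      exact this hr0
    have hN0 : r N = 0 := by
      have := Nat.find_min hex (m := N) (by omega)
      omega
    have hN1 : r (N + 1) = 1 := by
      have h₁ := Nat.find_spec hex
      rw [hN] at h₁
      have h₂ := hstep N
      rw [hN0] at h₂
      unfold avoidStep at h₂
      omega
    have hL : 0 < w.length := by
      have := hle (N + 1)
      omega
    -- every block read from state `1` differs from `w` and leads back to state `1`
    have key : ∀ s, r s = 1 → r (s + w.length) = 1 ∧
        ∃ d < w.length, x (s + d) ≠ w.getD d 0 := by
      intro s hs
      obtain ⟨c, hc⟩ : ∃ c, w.length = c + 1 := ⟨w.length - 1, by omega⟩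
      have h := hstep (s + c)
      rw [add_assoc, ← hc] at h
      rcases avoidStep_block hstep hs c (by omega) with ⟨h₁, h₂⟩ | ⟨h₁, d, hd, hne⟩
      · rw [h₁] at h
        simp only [avoidStep, Nat.add_sub_cancel] at h
        exact ⟨by omega, c, by omega, by omega⟩
      · rw [h₁] at h
        unfold avoidStep at h
        exact ⟨by omega, d, by omega, hne⟩
    have hone : ∀ j, r (N + 1 + j * w.length) = 1 := by
      intro j
      induction j with
      | zero => simpa using hN1
      | succ j ih =>
        rw [add_mul, one_mul, ← add_assoc]
        exact (key _ ih).1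
    refine ⟨N, fun j => ?_⟩
    obtain ⟨d, hd, hne⟩ := (key _ (hone j)).2
    exact ⟨d, hd, by simpa [hd] using hne⟩
  · rintro ⟨N, hN⟩
    obtain ⟨c₀, hL, -⟩ := hN 0
    replace hL : 0 < w.length := by omega
    classical
    -- the state after `c` letters of a block starting at `s`
    let S : ℕ → ℕ → ℕ := fun s c =>
      if ∀ d < c, x (s + d) = w.getD d 0 then c + 1 else w.length + c + 1
    let r : ℕ → ℕ := fun t => if t ≤ N then 0 else
      S (N + 1 + (t - (N + 1)) / w.length * w.length) ((t - (N + 1)) % w.length)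
    have hr : ∀ j c, c < w.length → r (N + 1 + j * w.length + c) = S (N + 1 + j * w.length) c := by
      intro j c hc
      simp only [r]
      rw [if_neg (by have := Nat.zero_le (j * w.length); omega)]
      have : N + 1 + j * w.length + c - (N + 1) = c + w.length * j := by
        rw [mul_comm w.length]; omega
      rw [this, Nat.add_mul_div_left _ _ hL, Nat.add_mul_mod_self_left, Nat.div_eq_of_lt hc,
        Nat.mod_eq_of_lt hc, zero_add]
    have hS0 : ∀ s, S s 0 = 1 := fun s => by simp [S]
    have hstart : r (N + 1) = 1 := by
      have := hr 0 0 hL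
      simpa [hS0] using this
    refine ⟨r, by simp [r], fun t => ?_, fun t => ?_, N + 1, by omega⟩
    · simp only [r, S]
      have := Nat.mod_lt (t - (N + 1)) hL
      split_ifs <;> omega
    · rcases lt_trichotomy t N with h | rfl | h
      · left
        simp only [r]
        rw [if_pos h.le, if_pos (by omega)]
        omega
      · left
        refine ⟨by simp [r], hstart.le⟩
      · obtain ⟨j, c, hc, rfl⟩ : ∃ j c, c < w.length ∧ t = N + 1 + j * w.length + c := by
          refine ⟨(t - (N + 1)) / w.length, (t - (N + 1)) % w.length, Nat.mod_lt _ hL, ?_⟩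
          have := Nat.div_add_mod' (t - (N + 1)) w.length
          omega
        have hrs := hr j
        obtain ⟨s, hs⟩ : ∃ s, s = N + 1 + j * w.length := ⟨_, rfl⟩
        rw [← hs] at hrs ⊢
        rw [hrs c hc]
        by_cases hc' : c + 1 < w.length
        · rw [add_assoc s, hrs (c + 1) hc']
          by_cases h₁ : ∀ d < c, x (s + d) = w.getD d 0
          · by_cases h₂ : x (s + c) = w.getD c 0
            · have h₃ : ∀ d < c + 1, x (s + d) = w.getD d 0 := fun d hd => by
                rcases Nat.lt_succ_iff_lt_or_eq.1 hd with h' | rfl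
                exacts [h₁ d h', h₂]
              simp only [S]
              rw [if_pos h₁, if_pos h₃]
              unfold avoidStep
              rw [Nat.add_sub_cancel]
              omega
            · have h₃ : ¬ ∀ d < c + 1, x (s + d) = w.getD d 0 := fun h => h₂ (h c (by omega))
              simp only [S]
              rw [if_pos h₁, if_neg h₃]
              unfold avoidStep
              rw [Nat.add_sub_cancel]
              omega
          · have h₃ : ¬ ∀ d < c + 1, x (s + d) = w.getD d 0 := fun h =>
              h₁ fun d hd => h d (by omega)
            simp only [S]
            rw [if_neg h₁, if_neg h₃]
            unfold avoidStep
            omega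
        · have hcL : c + 1 = w.length := by omega
          have hnext : r (s + c + 1) = 1 := by
            have h := hr (j + 1) 0 hL
            rw [hS0, add_mul] at h
            rw [← h]
            congr 1
            omega
          rw [hnext]
          by_cases h₁ : ∀ d < c, x (s + d) = w.getD d 0
          · have h₂ : x (s + c) ≠ w.getD c 0 := by
              obtain ⟨d, hd, hne⟩ := hN j
              rw [← hs] at hne
              rcases (show d < c ∨ d = c by omega) with h | rfl
              · have := h₁ d h
                simp [hd] at this
                exact absurd this hne
              · simpa [hd] using hne
            simp only [S]
            rw [if_pos h₁]
            unfold avoidStep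
            rw [Nat.add_sub_cancel]
            omega
          · simp only [S]
            rw [if_neg h₁]
            unfold avoidStep
            omega

theorem map_mem_avoiding {α β : Type*} {f : α → β} (hf : Function.Injective f) {w : List α}
    {x : ℕ → α} : (fun i => f (x i)) ∈ avoiding (w.map f) ↔ x ∈ avoiding w := by
  simp [avoiding, hf.ne_iff]

/-- A Büchi automaton with transitions `avoidStep w`, in which all states except the initial one
are final, accepts the words avoiding `w`. -/
theorem BuchiAutomaton.language_eq_avoiding {α : Type*} {w : List α} {f : α → ℕ}
    (hf : Function.Injective f) {n : ℕ} (hn : n = 2 * w.length)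
    {A : BuchiAutomaton α (Fin (n + 1))} (h₀ : A.q₀ = 0) (hF : ∀ p, p ∈ A.F ↔ p ≠ 0)
    (hδ : ∀ p a p', p' ∈ A.δ p a ↔ avoidStep (w.map f) p (f a) p') :
    A.language = avoiding w := by
  ext x
  rw [← map_mem_avoiding hf, ← exists_avoidRun_iff]
  constructor
  · rintro ⟨r, ⟨hr0, hr⟩, q, hq, hqF⟩
    obtain ⟨t, ht⟩ := hq.nonempty
    refine ⟨fun t => r t, by simp [hr0, h₀], fun t => ?_, fun t => (hδ _ _ _).1 (hr t), t, ?_⟩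
    · rw [List.length_map, ← hn]
      exact Nat.lt_succ_iff.1 (r t).2
    · have ht : r t = q := ht
      have hq0 := (hF q).1 hqF
      change (r t : ℕ) ≠ 0
      rw [ht]
      exact fun h => hq0 (Fin.ext h)
  · rintro ⟨r, hr0, hle, hstep, T, hT⟩
    have hpos : ∀ t, T ≤ t → 0 < r t := fun t ht => by
      induction t, ht using Nat.le_induction with
      | base => omega
      | succ t _ ih => exact avoidStep_pos (hstep t) ih
    rw [List.length_map, ← hn] at hle
    let ρ : ℕ → Fin (n + 1) := fun t => ⟨r t, Nat.lt_succ_iff.2 (hle t)⟩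
    refine ⟨ρ, ⟨?_, fun t => (hδ _ _ _).2 (hstep t)⟩, ?_⟩
    · rw [h₀]
      exact Fin.ext hr0
    · obtain ⟨q, hq⟩ : ∃ q, {t | T ≤ t ∧ ρ t = q}.Infinite := by
        by_contra! hcon
        refine Set.Ici_infinite T ((Set.finite_iUnion hcon).subset fun t ht => ?_)
        simpa using ht
      refine ⟨q, hq.mono fun t ht => ht.2, (hF q).2 ?_⟩
      obtain ⟨t, ht, rfl⟩ := hq.nonempty
      have := hpos t ht
      simp only [ρ, ne_eq, Fin.ext_iff, Fin.val_zero]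
      omega

end OmegaAutomata

/-! ### Primitive recursive predicates and search -/

section Primrec

variable {α β : Type*} [Primcodable α] [Primcodable β]

theorem PrimrecPred.forall_mem {l : α → List β} {p : α → β → Prop} (hl : Primrec l)
    (hp : PrimrecPred fun s : α × β => p s.1 s.2) : PrimrecPred fun a => ∀ b ∈ l a, p a b := by
  have hp' : PrimrecRel fun (b : β) (a : α) => p a b :=
    hp.comp (Primrec.snd.pair Primrec.fst)
  exact hp'.forall_mem_list.comp hl Primrec.id

theorem PrimrecPred.exists_mem {l : α → List β} {p : α → β → Prop} (hl : Primrec l)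
    (hp : PrimrecPred fun s : α × β => p s.1 s.2) : PrimrecPred fun a => ∃ b ∈ l a, p a b := by
  have hp' : PrimrecRel fun (b : β) (a : α) => p a b :=
    hp.comp (Primrec.snd.pair Primrec.fst)
  exact hp'.exists_mem_list.comp hl Primrec.id

theorem PrimrecPred.forall_lt' {n : α → ℕ} {p : α → ℕ → Prop} (hn : Primrec n)
    (hp : PrimrecPred fun s : α × ℕ => p s.1 s.2) : PrimrecPred fun a => ∀ i < n a, p a i :=
  (PrimrecPred.forall_mem (Primrec.list_range.comp hn) hp).of_eq (by simp)

theorem PrimrecPred.exists_lt' {n : α → ℕ} {p : α → ℕ → Prop} (hn : Primrec n)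
    (hp : PrimrecPred fun s : α × ℕ => p s.1 s.2) : PrimrecPred fun a => ∃ i < n a, p a i :=
  (PrimrecPred.exists_mem (Primrec.list_range.comp hn) hp).of_eq (by simp)

theorem PrimrecPred.mem {f : α → β} {l : α → List β} (hf : Primrec f) (hl : Primrec l) :
    PrimrecPred fun a => f a ∈ l a :=
  (PrimrecPred.exists_mem (p := fun a b => b = f a) hl
    (Primrec.eq.comp Primrec.snd (hf.comp Primrec.fst))).of_eq (by simp)

theorem PrimrecPred.iff {p q : α → Prop} (hp : PrimrecPred p) (hq : PrimrecPred q) :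
    PrimrecPred fun a => p a ↔ q a :=
  ((hp.and hq).or (hp.not.and hq.not)).of_eq fun a => by tauto

/-- Unbounded search: a total primitive recursive relation has a computable choice function. -/
theorem PrimrecRel.exists_computable {R : α → β → Prop} (hR : PrimrecRel R)
    (h : ∀ a, ∃ b, R a b) : ∃ f : α → β, Computable f ∧ ∀ a, R a (f a) := by
  classical
  let g : α → ℕ → Option β := fun a n =>
    (Encodable.decode (α := β) n).bind fun b => if R a b then some b else none
  have hg : Primrec₂ g := by
    refine Primrec.option_bind (Primrec.decode.comp Primrec.snd) ?_
    exact Primrec.ite (c := fun s : (α × ℕ) × β => R s.1.1 s.2)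
      (hR.comp (Primrec.fst.comp .fst) .snd) (Primrec.option_some.comp .snd) (.const none)
  have hdom : ∀ a, (Nat.rfindOpt (g a)).Dom := fun a => by
    obtain ⟨b, hb⟩ := h a
    exact Nat.rfindOpt_dom.2 ⟨Encodable.encode b, b, by simp [g, hb]⟩
  refine ⟨fun a => (Nat.rfindOpt (g a)).get (hdom a),
    (Partrec.rfindOpt hg.to_comp).of_eq fun a => (Part.some_get _).symm, fun a => ?_⟩
  obtain ⟨n, hn⟩ := Nat.rfindOpt_spec (Part.get_mem (hdom a))
  simp only [g, Option.mem_def, Option.bind_eq_some_iff] at hn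
  obtain ⟨b, -, hb⟩ := hn
  split_ifs at hb with hR'
  · convert hR' using 1
    exact (Option.some.inj hb).symm

end Primrec

namespace OmegaAutomata

open Set

/-! ### Profiles computed from descriptions of machines -/

/-- The triples describing the paths obtained by prolonging a path in the list `P` by a
transition with letter `a`. -/
def FSMCode.extend (c : FSMCode) (P : List (ℕ × List ℕ × ℕ)) (a : ℕ) : List (ℕ × List ℕ × ℕ) :=
  P.flatMap fun s =>
    (c.2.2.filter fun t => t.1 = s.2.2 ∧ t.2.1 = a ∧ t.2.2 ≤ c.1).map fun t =>
      (s.1, t.2.2 :: s.2.1, t.2.2)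

/-- A list of triples representing the profile of the word `u`; sets of states are represented
by lists. -/
def FSMCode.profileList (c : FSMCode) (u : List ℕ) : List (ℕ × List ℕ × ℕ) :=
  u.foldl c.extend ((List.range (c.1 + 1)).map fun q => (q, [], q))

/-- The described machine, reading natural numbers as letters, so that it does not depend on an
alphabet. -/
def FSMCode.natFSM (c : FSMCode) : FSM ℕ (Fin (c.1 + 1)) where
  δ q a := {p | ((q : ℕ), a, (p : ℕ)) ∈ c.2.2}
  q₀ := Fin.ofNat (c.1 + 1) c.2.1

theorem FSMCode.profile_toFSM {α : Type*} {k : ℕ} (e : α ≃ Fin k) (c : FSMCode)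
    (u : FreeMonoid α) : (FSMCode.toFSM e c).profile u =
      (FSMCode.natFSM c).profile (FreeMonoid.map (fun a => (e a : ℕ)) u) := by
  induction u using FreeMonoid.inductionOn' with
  | one => simp
  | of_mul a u ih =>
    rw [map_mul, map_mul, map_mul, ih, FreeMonoid.map_of]
    rfl

theorem FSMCode.mem_extend {c : FSMCode} {P : List (ℕ × List ℕ × ℕ)} {a q p : ℕ} {l : List ℕ} :
    (q, l, p) ∈ c.extend P a ↔ p ≤ c.1 ∧ ∃ l' s, (q, l', s) ∈ P ∧ (s, a, p) ∈ c.2.2 ∧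
      l = p :: l' := by
  simp only [FSMCode.extend, List.mem_flatMap, List.mem_map, List.mem_filter, decide_eq_true_eq,
    Prod.mk.injEq, Prod.exists]
  constructor
  · rintro ⟨q, l', s, h, _, _, p, ⟨h₁, rfl, rfl, hp⟩, rfl, rfl, rfl⟩
    exact ⟨hp, l', _, h, h₁, rfl⟩
  · rintro ⟨hp, l', s, h, h₁, rfl⟩
    exact ⟨q, l', s, h, s, a, p, ⟨h₁, rfl, rfl, hp⟩, rfl, rfl, rfl⟩

theorem FSMCode.le_of_mem_profileList {c : FSMCode} {u : List ℕ} {q p : ℕ} {l : List ℕ}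
    (h : (q, l, p) ∈ c.profileList u) : q ≤ c.1 ∧ p ≤ c.1 ∧ ∀ s ∈ l, s ≤ c.1 := by
  induction u using List.reverseRecOn generalizing l p with
  | nil =>
    simp only [FSMCode.profileList, List.foldl_nil, List.mem_map, List.mem_range,
      Prod.mk.injEq] at h
    obtain ⟨a, ha, rfl, rfl, rfl⟩ := h
    simp
    omega
  | append_singleton u a ih =>
    rw [FSMCode.profileList, List.foldl_concat] at h
    obtain ⟨hp, l', s, h', -, rfl⟩ := FSMCode.mem_extend.1 h
    obtain ⟨h₁, -, h₃⟩ := ih h'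
    refine ⟨h₁, hp, fun s hs => ?_⟩
    rcases List.mem_cons.1 hs with rfl | hs
    exacts [hp, h₃ s hs]

/-- The set of states represented by a list. -/
def stateSet (n : ℕ) (l : List ℕ) : Set (Fin (n + 1)) := {s | (s : ℕ) ∈ l}

theorem stateSet_eq_iff {n : ℕ} {l l' : List ℕ} (hl : ∀ s ∈ l, s ≤ n) (hl' : ∀ s ∈ l', s ≤ n) :
    stateSet n l = stateSet n l' ↔ (∀ s ∈ l, s ∈ l') ∧ ∀ s ∈ l', s ∈ l := by
  constructor
  · intro h
    exact ⟨fun s hs => (Set.ext_iff.1 h ⟨s, Nat.lt_succ_iff.2 (hl s hs)⟩).1 hs,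
      fun s hs => (Set.ext_iff.1 h ⟨s, Nat.lt_succ_iff.2 (hl' s hs)⟩).2 hs⟩
  · rintro ⟨h, h'⟩
    ext s
    exact ⟨h s, h' s⟩

theorem FSMCode.mem_profile {c : FSMCode} {u : List ℕ} {q p : Fin (c.1 + 1)}
    {I : Set (Fin (c.1 + 1))} : (q, I, p) ∈ c.natFSM.profile (FreeMonoid.ofList u) ↔
      ∃ l, ((q : ℕ), l, (p : ℕ)) ∈ c.profileList u ∧ I = stateSet c.1 l := by
  induction u using List.reverseRecOn generalizing I p with
  | nil =>
    rw [FreeMonoid.ofList_nil, map_one, Profile.mem_one]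
    simp only [FSMCode.profileList, List.foldl_nil, List.mem_map, List.mem_range, Prod.mk.injEq]
    constructor
    · rintro ⟨rfl, rfl⟩
      exact ⟨[], ⟨q, q.2, rfl, rfl, rfl⟩, by simp [stateSet]⟩
    · rintro ⟨l, ⟨a, -, h₁, rfl, h₂⟩, rfl⟩
      exact ⟨Fin.ext (h₁.symm.trans h₂), by simp [stateSet]⟩
  | append_singleton u a ih =>
    rw [FreeMonoid.ofList_append, FreeMonoid.ofList_singleton, map_mul, Profile.mem_mul,
      FSMCode.profileList, List.foldl_concat]
    simp only [FSMCode.mem_extend]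
    have hset : ∀ (p : Fin (c.1 + 1)) l, stateSet c.1 (p :: l) = stateSet c.1 l ∪ {p} := by
      intro p l
      ext s
      simp [stateSet, Fin.ext_iff]
    constructor
    · rintro ⟨J, s, J', h₁, h₂, rfl⟩
      obtain ⟨l', hl', rfl⟩ := ih.1 h₁
      obtain ⟨hp, rfl⟩ := FSM.mem_profile_of.1 h₂
      exact ⟨p :: l', ⟨Nat.lt_succ_iff.1 p.2, l', s, hl', hp, rfl⟩, (hset p l').symm⟩
    · rintro ⟨l, ⟨hp, l', s, h₁, h₂, rfl⟩, rfl⟩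
      have hs := (FSMCode.le_of_mem_profileList (c := c) (u := u) h₁).2.1
      refine ⟨stateSet c.1 l', ⟨s, Nat.lt_succ_iff.2 hs⟩, {p}, ih.2 ⟨l', h₁, rfl⟩,
        FSM.mem_profile_of.2 ⟨h₂, rfl⟩, hset p l'⟩

/-- Every path in `P` has the same endpoints and visits the same states as a path in `Q`. -/
def PathsSubset (P Q : List (ℕ × List ℕ × ℕ)) : Prop :=
  ∀ s ∈ P, ∃ t ∈ Q, s.1 = t.1 ∧ s.2.2 = t.2.2 ∧
    (∀ q ∈ s.2.1, q ∈ t.2.1) ∧ ∀ q ∈ t.2.1, q ∈ s.2.1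

/-- The words `u` and `v` have the same profile; a form accessible to algorithms. -/
def FSMCode.ProfileEq (c : FSMCode) (u v : List ℕ) : Prop :=
  PathsSubset (c.profileList u) (c.profileList v) ∧
    PathsSubset (c.profileList v) (c.profileList u)

theorem FSMCode.pathsSubset_iff {c : FSMCode} {u v : List ℕ} :
    PathsSubset (c.profileList u) (c.profileList v) ↔
      ∀ q I p, (q, I, p) ∈ c.natFSM.profile (FreeMonoid.ofList u) →
        (q, I, p) ∈ c.natFSM.profile (FreeMonoid.ofList v) := by
  constructor
  · intro h q I p hI
    obtain ⟨l, hl, rfl⟩ := FSMCode.mem_profile.1 hI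
    obtain ⟨⟨q', l', p'⟩, ht, h₁, h₂, h₃⟩ := h _ hl
    obtain rfl : (q : ℕ) = q' := h₁
    obtain rfl : (p : ℕ) = p' := h₂
    exact FSMCode.mem_profile.2 ⟨l', ht, (stateSet_eq_iff
      (FSMCode.le_of_mem_profileList hl).2.2 (FSMCode.le_of_mem_profileList ht).2.2).2 h₃⟩
  · rintro h ⟨q, l, p⟩ hs
    obtain ⟨hq, hp, hl⟩ := FSMCode.le_of_mem_profileList hs
    obtain ⟨l', hl', heq⟩ := FSMCode.mem_profile.1 (h ⟨q, Nat.lt_succ_iff.2 hq⟩ _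
      ⟨p, Nat.lt_succ_iff.2 hp⟩ (FSMCode.mem_profile.2 ⟨l, hs, rfl⟩))
    exact ⟨_, hl', rfl, rfl, (stateSet_eq_iff hl (FSMCode.le_of_mem_profileList hl').2.2).1 heq⟩

theorem FSMCode.profileEq_iff {c : FSMCode} {u v : List ℕ} :
    c.ProfileEq u v ↔ c.natFSM.profile (FreeMonoid.ofList u) =
      c.natFSM.profile (FreeMonoid.ofList v) := by
  rw [FSMCode.ProfileEq, FSMCode.pathsSubset_iff, FSMCode.pathsSubset_iff]
  constructor
  · rintro ⟨h, h'⟩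
    ext q I p
    exact ⟨h q I p, h' q I p⟩
  · intro h
    rw [h]
    exact ⟨fun _ _ _ => id, fun _ _ _ => id⟩

/-! ### Acceptance computed from descriptions of automata -/

/-- The machine underlying a described automaton. -/
def AutomatonCode.fsm (A : AutomatonCode) : FSMCode := Sum.elim Prod.fst Prod.fst A

/-- The sets of states which are accepting as sets of states entered infinitely often. -/
def AutomatonCode.family : (A : AutomatonCode) → Set (Set (Fin (A.fsm.1 + 1)))
  | Sum.inl c => {I | (I ∩ stateSet c.1.1 c.2).Nonempty}
  | Sum.inr c => {I | ∃ l ∈ c.2, I = stateSet c.1.1 l}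

theorem AutomatonCode.mem_language {α : Type*} {k : ℕ} (e : α ≃ Fin k) (A : AutomatonCode)
    (x : ℕ → α) : x ∈ A.language e ↔
      ∃ r, (FSMCode.toFSM e A.fsm).IsRun x r ∧ infStates r ∈ A.family := by
  cases A <;> rfl

/-- The set of states represented by a list is accepting; a form accessible to algorithms. -/
def AutomatonCode.AcceptsList : AutomatonCode → List ℕ → Prop
  | Sum.inl c, l => ∃ q ∈ l, q ∈ c.2
  | Sum.inr c, l => ∃ f ∈ c.2, (∀ q ∈ l, q ∈ f) ∧ ∀ q ∈ f, c.1.1 < q ∨ q ∈ l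

theorem AutomatonCode.acceptsList_iff {A : AutomatonCode} {l : List ℕ}
    (hl : ∀ s ∈ l, s ≤ A.fsm.1) : A.AcceptsList l ↔ stateSet A.fsm.1 l ∈ A.family := by
  rcases A with c | c
  · constructor
    · rintro ⟨q, hq, hqc⟩
      exact ⟨⟨q, Nat.lt_succ_iff.2 (hl q hq)⟩, hq, hqc⟩
    · rintro ⟨q, hq, hqc⟩
      exact ⟨q, hq, hqc⟩
  · constructor
    · rintro ⟨f, hf, h₁, h₂⟩
      refine ⟨f, hf, ?_⟩
      ext s
      exact ⟨h₁ s, fun hs => (h₂ s hs).resolve_left (not_lt.2 (Nat.lt_succ_iff.1 s.2))⟩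
    · rintro ⟨f, hf, h⟩
      refine ⟨f, hf, fun q hq => (Set.ext_iff.1 h ⟨q, Nat.lt_succ_iff.2 (hl q hq)⟩).1 hq,
        fun q hq => ?_⟩
      by_cases hqn : q ≤ c.1.1
      · exact Or.inr ((Set.ext_iff.1 h ⟨q, Nat.lt_succ_iff.2 hqn⟩).2 hq)
      · exact Or.inl (not_le.1 hqn)

/-- After the prefix `u`, a loop on `z` leads to acceptance; a form accessible to algorithms. -/
def AutomatonCode.AcceptsLoop (A : AutomatonCode) (u z : List ℕ) : Prop :=
  ∃ s ∈ A.fsm.profileList u, s.1 = A.fsm.2.1 % (A.fsm.1 + 1) ∧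
    ∃ t ∈ A.fsm.profileList z, t.1 = s.2.2 ∧ t.2.2 = s.2.2 ∧ A.AcceptsList t.2.1

theorem AutomatonCode.acceptsLoop_iff {A : AutomatonCode} {u z : List ℕ} :
    A.AcceptsLoop u z ↔ A.fsm.natFSM.Accepting A.family
      (A.fsm.natFSM.profile (FreeMonoid.ofList u))
      (A.fsm.natFSM.profile (FreeMonoid.ofList z)) := by
  constructor
  · rintro ⟨⟨q₀, l, q⟩, hs, rfl, ⟨q₁, l', q₂⟩, ht, h₁, h₂, hacc⟩
    obtain rfl : q₁ = q := h₁
    obtain rfl : q₂ = q₁ := h₂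
    have hq := Nat.lt_succ_iff.2 (FSMCode.le_of_mem_profileList hs).2.1
    exact ⟨⟨_, hq⟩, _, _, FSMCode.mem_profile.2 ⟨l, hs, rfl⟩, FSMCode.mem_profile.2 ⟨l', ht, rfl⟩,
      (AutomatonCode.acceptsList_iff (FSMCode.le_of_mem_profileList ht).2.2).1 hacc⟩
  · rintro ⟨q, I, J, h₁, h₂, hJ⟩
    obtain ⟨l, hl, rfl⟩ := FSMCode.mem_profile.1 h₁
    obtain ⟨l', hl', rfl⟩ := FSMCode.mem_profile.1 h₂
    exact ⟨_, hl, rfl, _, hl', rfl, rfl,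
      (AutomatonCode.acceptsList_iff (FSMCode.le_of_mem_profileList hl').2.2).2 hJ⟩

/-! ### Primitive recursiveness -/

section Primrec

variable {σ : Type*} [Primcodable σ]

theorem FSMCode.primrec_profileList : Primrec₂ FSMCode.profileList := by
  have hfilter : Primrec₂ fun (L : List (ℕ × ℕ × ℕ)) (b : ℕ × ℕ × ℕ) =>
      L.filter fun t => t.1 = b.1 ∧ t.2.1 = b.2.1 ∧ t.2.2 ≤ b.2.2 := by
    refine PrimrecRel.listFilter (R := fun (t b : ℕ × ℕ × ℕ) =>
      t.1 = b.1 ∧ t.2.1 = b.2.1 ∧ t.2.2 ≤ b.2.2) ?_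
    refine (Primrec.eq.comp (Primrec.fst.comp .fst) (Primrec.fst.comp .snd)).and
      ((Primrec.eq.comp (Primrec.fst.comp (Primrec.snd.comp .fst))
        (Primrec.fst.comp (Primrec.snd.comp .snd))).and
      (Primrec.nat_le.comp (Primrec.snd.comp (Primrec.snd.comp .fst))
        (Primrec.snd.comp (Primrec.snd.comp .snd))))
  have hextend : Primrec fun s : FSMCode × List (ℕ × List ℕ × ℕ) × ℕ =>
      s.1.extend s.2.1 s.2.2 := by
    refine Primrec.list_flatMap (Primrec.fst.comp .snd) ?_
    refine Primrec.list_map (hfilter.comp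
      (g := fun s : (FSMCode × List (ℕ × List ℕ × ℕ) × ℕ) × ℕ × List ℕ × ℕ => s.1.1.2.2)
      (h := fun s => (s.2.2.2, s.1.2.2, s.1.1.1)) ?_ ?_) ?_
    · exact Primrec.snd.comp (Primrec.snd.comp (Primrec.fst.comp .fst))
    · exact (Primrec.snd.comp (Primrec.snd.comp .snd)).pair
        ((Primrec.snd.comp (Primrec.snd.comp .fst)).pair
          (Primrec.fst.comp (Primrec.fst.comp .fst)))
    · exact (Primrec.fst.comp (Primrec.snd.comp .fst)).pair
        ((Primrec.list_cons.comp (Primrec.snd.comp (Primrec.snd.comp .snd))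
          (Primrec.fst.comp (Primrec.snd.comp (Primrec.snd.comp .fst)))).pair
          (Primrec.snd.comp (Primrec.snd.comp .snd)))
  refine Primrec.list_foldl (f := fun s : FSMCode × List ℕ => s.2)
    (g := fun s => (List.range (s.1.1 + 1)).map fun q => (q, [], q))
    (h := fun s t => s.1.extend t.1 t.2) .snd ?_ ?_
  · refine Primrec.list_map (Primrec.list_range.comp
      (Primrec.succ.comp (Primrec.fst.comp .fst))) ?_
    exact Primrec.snd.pair ((Primrec.const []).pair .snd)
  · exact hextend.comp ((Primrec.fst.comp .fst).pair .snd)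

theorem primrecPred_pathsSubset {P Q : σ → List (ℕ × List ℕ × ℕ)} (hP : Primrec P)
    (hQ : Primrec Q) : PrimrecPred fun a => PathsSubset (P a) (Q a) := by
  refine PrimrecPred.forall_mem hP (PrimrecPred.exists_mem (hQ.comp .fst) ?_)
  refine (Primrec.eq.comp (Primrec.fst.comp (Primrec.snd.comp .fst)) (Primrec.fst.comp .snd)).and
    ((Primrec.eq.comp (Primrec.snd.comp (Primrec.snd.comp (Primrec.snd.comp .fst)))
      (Primrec.snd.comp (Primrec.snd.comp .snd))).and (PrimrecPred.and ?_ ?_))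
  · refine PrimrecPred.forall_mem (Primrec.fst.comp (Primrec.snd.comp (Primrec.snd.comp .fst)))
      (PrimrecPred.mem .snd (Primrec.fst.comp (Primrec.snd.comp (Primrec.snd.comp .fst))))
  · refine PrimrecPred.forall_mem (Primrec.fst.comp (Primrec.snd.comp .snd))
      (PrimrecPred.mem .snd
        (Primrec.fst.comp (Primrec.snd.comp (Primrec.snd.comp (Primrec.fst.comp .fst)))))

theorem FSMCode.primrecPred_profileEq {c : σ → FSMCode} {u v : σ → List ℕ} (hc : Primrec c)
    (hu : Primrec u) (hv : Primrec v) : PrimrecPred fun a => (c a).ProfileEq (u a) (v a) :=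
  (primrecPred_pathsSubset (FSMCode.primrec_profileList.comp hc hu)
    (FSMCode.primrec_profileList.comp hc hv)).and
  (primrecPred_pathsSubset (FSMCode.primrec_profileList.comp hc hv)
    (FSMCode.primrec_profileList.comp hc hu))

theorem AutomatonCode.primrec_fsm : Primrec AutomatonCode.fsm :=
  (Primrec.sumCasesOn (f := fun A : AutomatonCode => A) (g := fun _ c => c.1)
    (h := fun _ c => c.1) .id (Primrec.fst.comp .snd) (Primrec.fst.comp .snd)).of_eq fun A => by
    cases A <;> rfl

theorem AutomatonCode.primrecRel_acceptsList : PrimrecRel AutomatonCode.AcceptsList := by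
  classical
  have h₁ : PrimrecRel fun (c : BuchiCode) (l : List ℕ) => ∃ q ∈ l, q ∈ c.2 :=
    PrimrecPred.exists_mem .snd (PrimrecPred.mem .snd (Primrec.snd.comp (Primrec.fst.comp .fst)))
  have h₂ : PrimrecRel fun (c : MullerCode) (l : List ℕ) =>
      ∃ f ∈ c.2, (∀ q ∈ l, q ∈ f) ∧ ∀ q ∈ f, c.1.1 < q ∨ q ∈ l := by
    refine PrimrecPred.exists_mem (Primrec.snd.comp .fst) (PrimrecPred.and ?_ ?_)
    · exact PrimrecPred.forall_mem (Primrec.snd.comp .fst)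
        (PrimrecPred.mem .snd (Primrec.snd.comp .fst))
    · refine PrimrecPred.forall_mem .snd (PrimrecPred.or ?_ ?_)
      · exact Primrec.nat_lt.comp
          (Primrec.fst.comp (Primrec.fst.comp (Primrec.fst.comp (Primrec.fst.comp .fst)))) .snd
      · exact PrimrecPred.mem .snd (Primrec.snd.comp (Primrec.fst.comp .fst))
  refine Primrec.primrecPred ((Primrec.sumCasesOn (f := fun s : AutomatonCode × List ℕ => s.1)
    (g := fun s c => decide (∃ q ∈ s.2, q ∈ c.2))
    (h := fun s c => decide (∃ f ∈ c.2, (∀ q ∈ s.2, q ∈ f) ∧ ∀ q ∈ f, c.1.1 < q ∨ q ∈ s.2))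
    .fst ?_ ?_).of_eq ?_)
  · exact (h₁.comp (f := fun s : (AutomatonCode × List ℕ) × BuchiCode => s.2) .snd
      (Primrec.snd.comp .fst)).decide
  · exact (h₂.comp (f := fun s : (AutomatonCode × List ℕ) × MullerCode => s.2) .snd
      (Primrec.snd.comp .fst)).decide
  · rintro ⟨c | c, l⟩ <;> exact decide_eq_decide.2 Iff.rfl

theorem AutomatonCode.primrecPred_acceptsLoop {A : σ → AutomatonCode} {u z : σ → List ℕ}
    (hA : Primrec A) (hu : Primrec u) (hz : Primrec z) :
    PrimrecPred fun a => (A a).AcceptsLoop (u a) (z a) := by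
  have hfsm := AutomatonCode.primrec_fsm.comp hA
  refine PrimrecPred.exists_mem (FSMCode.primrec_profileList.comp hfsm hu) (PrimrecPred.and ?_ ?_)
  · exact Primrec.eq.comp (Primrec.fst.comp .snd) (Primrec.nat_mod.comp
      (Primrec.fst.comp (Primrec.snd.comp (hfsm.comp .fst)))
      (Primrec.succ.comp (Primrec.fst.comp (hfsm.comp .fst))))
  · refine PrimrecPred.exists_mem ((FSMCode.primrec_profileList.comp hfsm hz).comp .fst)
      (PrimrecPred.and ?_ (PrimrecPred.and ?_ ?_))
    · exact Primrec.eq.comp (Primrec.fst.comp .snd)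
        (Primrec.snd.comp (Primrec.snd.comp (Primrec.snd.comp .fst)))
    · exact Primrec.eq.comp (Primrec.snd.comp (Primrec.snd.comp .snd))
        (Primrec.snd.comp (Primrec.snd.comp (Primrec.snd.comp .fst)))
    · exact AutomatonCode.primrecRel_acceptsList.comp (hA.comp (Primrec.fst.comp .fst))
        (Primrec.fst.comp (Primrec.snd.comp .snd))

theorem primrecPred_avoidStep {w : σ → List ℕ} {p a p' : σ → ℕ} (hw : Primrec w)
    (hp : Primrec p) (ha : Primrec a) (hp' : Primrec p') :
    PrimrecPred fun s => avoidStep (w s) (p s) (a s) (p' s) := by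
  have hlen := Primrec.list_length.comp hw
  have h0 : PrimrecPred fun s => 0 < p s := Primrec.nat_lt.comp (.const 0) hp
  have hsucc : PrimrecPred fun s => p' s = p s + 1 := Primrec.eq.comp hp' (Primrec.succ.comp hp)
  have hone : PrimrecPred fun s => p' s = 1 := Primrec.eq.comp hp' (.const 1)
  have hletter : PrimrecPred fun s => a s = (w s).getD (p s - 1) 0 :=
    Primrec.eq.comp ha ((Primrec.list_getD 0).comp hw (Primrec.nat_sub.comp hp (.const 1)))
  have hdouble : Primrec fun s => 2 * (w s).length := Primrec.nat_mul.comp (.const 2) hlen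
  refine PrimrecPred.or ?_ (PrimrecPred.or ?_ (PrimrecPred.or ?_ (PrimrecPred.or ?_
    (PrimrecPred.or ?_ ?_))))
  · exact (Primrec.eq.comp hp (.const 0)).and (Primrec.nat_le.comp hp' (.const 1))
  · exact h0.and ((Primrec.nat_lt.comp hp hlen).and (hletter.and hsucc))
  · exact h0.and ((Primrec.nat_lt.comp hp hlen).and (hletter.not.and
      (Primrec.eq.comp hp' (Primrec.succ.comp (Primrec.nat_add.comp hlen hp)))))
  · exact h0.and ((Primrec.eq.comp hp hlen).and (hletter.not.and hone))
  · exact (Primrec.nat_lt.comp hlen hp).and ((Primrec.nat_lt.comp hp hdouble).and hsucc)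
  · exact (Primrec.nat_lt.comp hlen hp).and ((Primrec.eq.comp hp hdouble).and hone)

end Primrec

/-! ### Certificates -/

/-- The decidable condition on which the algorithm searches. The words in the list `U` represent
all profiles, `z` is locally invertible, `B` follows the representative of the profile of the
prefix read so far until acceptance is decided, and `C` accepts the words avoiding `z ++ z`.
The states of `B` are positions in `U`. A final state of `B` may be kept on every letter, which
makes acceptance depend on a prefix only. Initial states are read modulo the number of states. -/
structure IsCertificate (k : ℕ) (A : AutomatonCode) (B C : BuchiCode) (U : List (List ℕ))
    (z : List ℕ) : Prop where
  word_zero : U.getD 0 [] = []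
  word_append : ∀ i < B.1.1 + 1, ∀ a < k, ∃ j < B.1.1 + 1,
    A.fsm.ProfileEq (U.getD i [] ++ [a]) (U.getD j [])
  idem : A.fsm.ProfileEq (z ++ z) z
  inv : ∀ i < B.1.1 + 1, ∃ j < B.1.1 + 1,
    A.fsm.ProfileEq (z ++ U.getD i [] ++ z ++ U.getD j [] ++ z) z ∧
    A.fsm.ProfileEq (z ++ U.getD j [] ++ z ++ U.getD i [] ++ z) z
  open_start : B.1.2.1 % (B.1.1 + 1) = 0
  open_step : ∀ i < B.1.1 + 1, ∀ a < k, ∀ j < B.1.1 + 1, (i, a, j) ∈ B.1.2.2 ↔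
    (A.fsm.ProfileEq (U.getD i [] ++ [a]) (U.getD j []) ∨ (i = j ∧ i ∈ B.2))
  open_final : ∀ i < B.1.1 + 1, i ∈ B.2 ↔
    A.fsm.ProfileEq (U.getD i [] ++ z) (U.getD i []) ∧ A.AcceptsLoop (U.getD i []) z
  letters : ∀ a ∈ z, a < k
  meager_size : C.1.1 = 2 * (z ++ z).length
  meager_start : C.1.2.1 % (C.1.1 + 1) = 0
  meager_step : ∀ p < C.1.1 + 1, ∀ a < k, ∀ p' < C.1.1 + 1,
    (p, a, p') ∈ C.1.2.2 ↔ avoidStep (z ++ z) p a p'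
  meager_final : ∀ p < C.1.1 + 1, p ∈ C.2 ↔ ¬ p = 0

theorem isCertificate_iff {k : ℕ} {A : AutomatonCode} {B C : BuchiCode} {U : List (List ℕ)}
    {z : List ℕ} : IsCertificate k A B C U z ↔
    U.getD 0 [] = [] ∧
    (∀ i < B.1.1 + 1, ∀ a < k, ∃ j < B.1.1 + 1,
      A.fsm.ProfileEq (U.getD i [] ++ [a]) (U.getD j [])) ∧
    A.fsm.ProfileEq (z ++ z) z ∧
    (∀ i < B.1.1 + 1, ∃ j < B.1.1 + 1,
      A.fsm.ProfileEq (z ++ U.getD i [] ++ z ++ U.getD j [] ++ z) z ∧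
      A.fsm.ProfileEq (z ++ U.getD j [] ++ z ++ U.getD i [] ++ z) z) ∧
    B.1.2.1 % (B.1.1 + 1) = 0 ∧
    (∀ i < B.1.1 + 1, ∀ a < k, ∀ j < B.1.1 + 1, (i, a, j) ∈ B.1.2.2 ↔
      (A.fsm.ProfileEq (U.getD i [] ++ [a]) (U.getD j []) ∨ (i = j ∧ i ∈ B.2))) ∧
    (∀ i < B.1.1 + 1, i ∈ B.2 ↔
      A.fsm.ProfileEq (U.getD i [] ++ z) (U.getD i []) ∧ A.AcceptsLoop (U.getD i []) z) ∧
    (∀ a ∈ z, a < k) ∧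
    C.1.1 = 2 * (z ++ z).length ∧
    C.1.2.1 % (C.1.1 + 1) = 0 ∧
    (∀ p < C.1.1 + 1, ∀ a < k, ∀ p' < C.1.1 + 1,
      (p, a, p') ∈ C.1.2.2 ↔ avoidStep (z ++ z) p a p') ∧
    (∀ p < C.1.1 + 1, p ∈ C.2 ↔ ¬ p = 0) :=
  ⟨fun ⟨h₁, h₂, h₃, h₄, h₅, h₆, h₇, h₈, h₉, h₁₀, h₁₁, h₁₂⟩ =>
      ⟨h₁, h₂, h₃, h₄, h₅, h₆, h₇, h₈, h₉, h₁₀, h₁₁, h₁₂⟩,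
    fun ⟨h₁, h₂, h₃, h₄, h₅, h₆, h₇, h₈, h₉, h₁₀, h₁₁, h₁₂⟩ =>
      ⟨h₁, h₂, h₃, h₄, h₅, h₆, h₇, h₈, h₉, h₁₀, h₁₁, h₁₂⟩⟩

theorem primrecPred_isCertificate {σ : Type*} [Primcodable σ] {k : σ → ℕ}
    {A : σ → AutomatonCode} {B C : σ → BuchiCode} {U : σ → List (List ℕ)} {z : σ → List ℕ}
    (hk : Primrec k) (hA : Primrec A) (hB : Primrec B) (hC : Primrec C) (hU : Primrec U)
    (hz : Primrec z) :
    PrimrecPred fun s => IsCertificate (k s) (A s) (B s) (C s) (U s) (z s) := by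
  have hc := AutomatonCode.primrec_fsm.comp hA
  have hm : Primrec fun s => (B s).1.1 + 1 :=
    Primrec.succ.comp (Primrec.fst.comp (Primrec.fst.comp hB))
  have hn : Primrec fun s => (C s).1.1 + 1 :=
    Primrec.succ.comp (Primrec.fst.comp (Primrec.fst.comp hC))
  have hzz : Primrec fun s => z s ++ z s := Primrec.list_append.comp hz hz
  have hword := Primrec.list_getD (α := List ℕ) []
  refine PrimrecPred.of_eq (PrimrecPred.and ?_ (PrimrecPred.and ?_ (PrimrecPred.and ?_
    (PrimrecPred.and ?_ (PrimrecPred.and ?_ (PrimrecPred.and ?_ (PrimrecPred.and ?_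
    (PrimrecPred.and ?_ (PrimrecPred.and ?_ (PrimrecPred.and ?_
    (PrimrecPred.and ?_ ?_))))))))))) fun s => isCertificate_iff.symm
  · exact Primrec.eq.comp (hword.comp hU (.const 0)) (.const [])
  · refine PrimrecPred.forall_lt' hm (PrimrecPred.forall_lt' (hk.comp .fst)
      (PrimrecPred.exists_lt' (hm.comp (Primrec.fst.comp .fst)) ?_))
    have h₁ := Primrec.fst.comp (Primrec.fst.comp (Primrec.fst (α := (σ × ℕ) × ℕ) (β := ℕ)))
    exact FSMCode.primrecPred_profileEq (hc.comp h₁)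
      (Primrec.list_concat.comp (hword.comp (hU.comp h₁) (Primrec.snd.comp (Primrec.fst.comp .fst)))
        (Primrec.snd.comp .fst)) (hword.comp (hU.comp h₁) .snd)
  · exact FSMCode.primrecPred_profileEq hc hzz hz
  · refine PrimrecPred.forall_lt' hm (PrimrecPred.exists_lt' (hm.comp .fst) ?_)
    have h₁ := Primrec.fst.comp (Primrec.fst (α := σ × ℕ) (β := ℕ))
    have hi := hword.comp (hU.comp h₁) (Primrec.snd.comp (Primrec.fst (α := σ × ℕ) (β := ℕ)))
    have hj := hword.comp (hU.comp h₁) (Primrec.snd (α := σ × ℕ) (β := ℕ))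
    have hz' := hz.comp h₁
    have happ : ∀ {f g : (σ × ℕ) × ℕ → List ℕ}, Primrec f → Primrec g →
        Primrec fun s => f s ++ g s := fun hf hg => Primrec.list_append.comp hf hg
    exact (FSMCode.primrecPred_profileEq (hc.comp h₁)
        (happ (happ (happ (happ hz' hi) hz') hj) hz') hz').and
      (FSMCode.primrecPred_profileEq (hc.comp h₁)
        (happ (happ (happ (happ hz' hj) hz') hi) hz') hz')
  · exact Primrec.eq.comp (Primrec.nat_mod.comp
      (Primrec.fst.comp (Primrec.snd.comp (Primrec.fst.comp hB))) hm) (.const 0)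
  · refine PrimrecPred.forall_lt' hm (PrimrecPred.forall_lt' (hk.comp .fst)
      (PrimrecPred.forall_lt' (hm.comp (Primrec.fst.comp .fst)) (PrimrecPred.iff ?_
        (PrimrecPred.or ?_ (PrimrecPred.and ?_ ?_)))))
    all_goals
      have h₁ := Primrec.fst.comp (Primrec.fst.comp (Primrec.fst (α := (σ × ℕ) × ℕ) (β := ℕ)))
      have hi := Primrec.snd.comp (Primrec.fst.comp (Primrec.fst (α := (σ × ℕ) × ℕ) (β := ℕ)))
      have ha := Primrec.snd.comp (Primrec.fst (α := (σ × ℕ) × ℕ) (β := ℕ))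
      have hj := Primrec.snd (α := (σ × ℕ) × ℕ) (β := ℕ)
    · exact PrimrecPred.mem (hi.pair (ha.pair hj))
        (Primrec.snd.comp (Primrec.snd.comp (Primrec.fst.comp (hB.comp h₁))))
    · exact FSMCode.primrecPred_profileEq (hc.comp h₁)
        (Primrec.list_concat.comp (hword.comp (hU.comp h₁) hi) ha) (hword.comp (hU.comp h₁) hj)
    · exact Primrec.eq.comp hi hj
    · exact PrimrecPred.mem hi (Primrec.snd.comp (hB.comp h₁))
  · have hi := hword.comp (hU.comp .fst) (Primrec.snd (α := σ) (β := ℕ))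
    refine PrimrecPred.forall_lt' hm (PrimrecPred.iff
      (PrimrecPred.mem .snd (Primrec.snd.comp (hB.comp .fst))) (PrimrecPred.and ?_ ?_))
    · exact FSMCode.primrecPred_profileEq (hc.comp .fst)
        (Primrec.list_append.comp hi (hz.comp .fst)) hi
    · exact AutomatonCode.primrecPred_acceptsLoop (hA.comp .fst) hi (hz.comp .fst)
  · exact PrimrecPred.forall_mem hz (Primrec.nat_lt.comp .snd (hk.comp .fst))
  · exact Primrec.eq.comp (Primrec.fst.comp (Primrec.fst.comp hC))
      (Primrec.nat_mul.comp (.const 2) (Primrec.list_length.comp hzz))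
  · exact Primrec.eq.comp (Primrec.nat_mod.comp
      (Primrec.fst.comp (Primrec.snd.comp (Primrec.fst.comp hC))) hn) (.const 0)
  · refine PrimrecPred.forall_lt' hn (PrimrecPred.forall_lt' (hk.comp .fst)
      (PrimrecPred.forall_lt' (hn.comp (Primrec.fst.comp .fst)) (PrimrecPred.iff ?_ ?_)))
    all_goals
      have h₁ := Primrec.fst.comp (Primrec.fst.comp (Primrec.fst (α := (σ × ℕ) × ℕ) (β := ℕ)))
      have hi := Primrec.snd.comp (Primrec.fst.comp (Primrec.fst (α := (σ × ℕ) × ℕ) (β := ℕ)))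
      have ha := Primrec.snd.comp (Primrec.fst (α := (σ × ℕ) × ℕ) (β := ℕ))
      have hj := Primrec.snd (α := (σ × ℕ) × ℕ) (β := ℕ)
    · exact PrimrecPred.mem (hi.pair (ha.pair hj))
        (Primrec.snd.comp (Primrec.snd.comp (Primrec.fst.comp (hC.comp h₁))))
    · exact primrecPred_avoidStep (hzz.comp h₁) hi ha hj
  · exact PrimrecPred.forall_lt' hn (PrimrecPred.iff
      (PrimrecPred.mem .snd (Primrec.snd.comp (hC.comp .fst)))
      (Primrec.eq.comp .snd (.const 0)).not)

/-! ### Existence of certificates -/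

/-- A locally invertible word `z` exists because the profiles form a finite monoid, and the
descriptions of `B` and `C` exist because every finite automaton has a description. -/
theorem exists_isCertificate (k : ℕ) (A : AutomatonCode) :
    ∃ B C U z, IsCertificate k A B C U z := by
  classical
  set c := A.fsm with hc
  let N := c.natFSM
  let toNat : FreeMonoid (Fin k) →* FreeMonoid ℕ := FreeMonoid.map (fun a : Fin k => (a : ℕ))
  let φ : FreeMonoid (Fin k) →* Profile (Fin (c.1 + 1)) := N.profile.comp toNat
  have hlist : ∀ l : List (Fin k), N.profile (FreeMonoid.ofList (l.map fun a : Fin k => (a : ℕ))) =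
      φ (FreeMonoid.ofList l) := fun l => rfl
  obtain ⟨⟨_, z', rfl⟩, he, hinv⟩ := exists_idempotent_local_group (MonoidHom.mrange φ)
  replace he : φ z' * φ z' = φ z' := congrArg Subtype.val he
  obtain ⟨n, ⟨enum⟩⟩ := Finite.exists_equiv_fin (MonoidHom.mrange φ)
  choose rep hrep using fun P : MonoidHom.mrange φ => P.2
  -- the empty word, followed by a representative for each profile
  let V : List (List (Fin k)) :=
    [] :: List.ofFn fun i => FreeMonoid.toList (rep (enum.symm i))
  let U : List (List ℕ) := V.map fun l => l.map fun a : Fin k => (a : ℕ)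
  have hV : V.length = n + 1 := by simp [V]
  have hU : ∀ i, U.getD i [] = (V.getD i []).map fun a : Fin k => (a : ℕ) := fun i => by
    simp only [U, List.getD_eq_getElem?_getD, List.getElem?_map]
    cases V[i]? <;> rfl
  have hcover : ∀ u, ∃ j < n + 1, φ (FreeMonoid.ofList (V.getD j [])) = φ u := by
    intro u
    refine ⟨enum ⟨φ u, u, rfl⟩ + 1, by omega, ?_⟩
    have : V.getD (enum ⟨φ u, u, rfl⟩ + 1) [] = FreeMonoid.toList (rep ⟨φ u, u, rfl⟩) := by
      simp [V]
    rw [this]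
    exact hrep ⟨φ u, u, rfl⟩
  let z : List ℕ := (FreeMonoid.toList z').map fun a : Fin k => (a : ℕ)
  have hz : N.profile (FreeMonoid.ofList z) = φ z' := rfl
  have hw : ∀ i, N.profile (FreeMonoid.ofList (U.getD i [])) =
      φ (FreeMonoid.ofList (V.getD i [])) := fun i => by rw [hU, hlist]
  obtain ⟨i₀, t, F, hB⟩ := exists_buchiCode (Equiv.refl (Fin k)) (n := n)
    { δ := fun i a => {j | c.ProfileEq (U.getD i [] ++ [(a : ℕ)]) (U.getD j []) ∨
        (i = j ∧ c.ProfileEq (U.getD i [] ++ z) (U.getD i []) ∧ A.AcceptsLoop (U.getD i []) z)}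
      q₀ := 0
      F := {i | c.ProfileEq (U.getD i [] ++ z) (U.getD i []) ∧ A.AcceptsLoop (U.getD i []) z} }
  obtain ⟨i₁, t', F', hC⟩ := exists_buchiCode (Equiv.refl (Fin k)) (n := 2 * (z ++ z).length)
    { δ := fun p a => {p' | avoidStep (z ++ z) p a p'}
      q₀ := 0
      F := {p | ¬ (p : ℕ) = 0} }
  have hBF : ∀ i (hi : i < n + 1), i ∈ F ↔
      c.ProfileEq (U.getD i [] ++ z) (U.getD i []) ∧ A.AcceptsLoop (U.getD i []) z :=
    fun i hi => Set.ext_iff.1 (congrArg BuchiAutomaton.F hB) ⟨i, hi⟩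
  refine ⟨((n, i₀, t), F), ((_, i₁, t'), F'), U, z, ?_, ?_, ?_, ?_, ?_, ?_, hBF, ?_, rfl, ?_, ?_, ?_⟩
  · rw [hU]; rfl
  · intro i _ a ha
    obtain ⟨j, hj, h⟩ := hcover (FreeMonoid.ofList (V.getD i [] ++ [⟨a, ha⟩]))
    refine ⟨j, hj, FSMCode.profileEq_iff.2 ?_⟩
    change N.profile _ = N.profile _
    rw [hw, h, ← hlist, hU, List.map_append]
    rfl
  · rw [FSMCode.profileEq_iff]
    change N.profile _ = N.profile _
    rw [FreeMonoid.ofList_append, map_mul, hz, he]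
  · intro i _
    obtain ⟨⟨_, y, rfl⟩, h₁, h₂⟩ := hinv ⟨_, FreeMonoid.ofList (V.getD i []), rfl⟩
    replace h₁ := congrArg Subtype.val h₁
    replace h₂ := congrArg Subtype.val h₂
    simp only [Submonoid.coe_mul] at h₁ h₂
    obtain ⟨j, hj, h⟩ := hcover y
    refine ⟨j, hj, FSMCode.profileEq_iff.2 ?_, FSMCode.profileEq_iff.2 ?_⟩
    all_goals
      change N.profile _ = N.profile _
      simp only [FreeMonoid.ofList_append, map_mul]
      rw [hz, hw, hw, h]
      assumption
  · exact congrArg Fin.val (congrArg (fun A => A.q₀) hB)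
  · intro i hi a ha j hj
    refine (iff_of_eq (congrArg (fun A => (⟨j, hj⟩ : Fin (n + 1)) ∈ A.δ ⟨i, hi⟩ ⟨a, ha⟩)
      hB)).trans ?_
    rw [hBF i hi]
    simp only [mem_ofPred_eq, Fin.mk.injEq]
    rfl
  · intro a ha
    obtain ⟨b, -, rfl⟩ := List.mem_map.1 ha
    exact b.2
  · exact congrArg Fin.val (congrArg (fun A => A.q₀) hC)
  · intro p hp a ha p' hp'
    exact iff_of_eq (congrArg (fun A => (⟨p', hp'⟩ : Fin _) ∈ A.δ ⟨p, hp⟩ ⟨a, ha⟩) hC)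
  · intro p hp
    exact Set.ext_iff.1 (congrArg BuchiAutomaton.F hC) ⟨p, hp⟩

/-! ### Correctness of certificates -/

theorem isOpen_ofPred_factor {α : Type*} [TopologicalSpace α] [DiscreteTopology α]
    (p : FreeMonoid α → Prop) (n : ℕ) : IsOpen {x : ℕ → α | p (factor x 0 n)} := by
  refine isOpen_pi_iff.2 fun x hx => ⟨Finset.range n, fun i => {x i},
    fun i _ => ⟨isOpen_discrete _, rfl⟩, fun y hy => ?_⟩
  have : factor y 0 n = factor x 0 n := by
    refine congrArg FreeMonoid.ofList (List.map_congr_left fun i hi => ?_)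
    exact hy i (by simpa using (List.Ico.mem.1 hi).2)
  change p (factor y 0 n)
  rwa [this]

namespace IsCertificate

variable {α : Type*} {k : ℕ} {A : AutomatonCode} {B C : BuchiCode} {U : List (List ℕ)}
  {z : List ℕ}

/-- Every profile of a word over the alphabet is represented in the list `U`. -/
theorem exists_word (h : IsCertificate k A B C U z) (e : α ≃ Fin k) (u : List α) :
    ∃ j < B.1.1 + 1, (FSMCode.toFSM e A.fsm).profile (FreeMonoid.ofList u) =
      A.fsm.natFSM.profile (FreeMonoid.ofList (U.getD j [])) := by
  induction u using List.reverseRecOn with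
  | nil => exact ⟨0, by omega, by rw [h.word_zero]; simp⟩
  | append_singleton u a ih =>
    obtain ⟨i, hi, hu⟩ := ih
    obtain ⟨j, hj, heq⟩ := h.word_append i hi (e a) (e a).2
    refine ⟨j, hj, ?_⟩
    rw [← FSMCode.profileEq_iff.1 heq, FreeMonoid.ofList_append, map_mul, hu,
      FreeMonoid.ofList_append, map_mul]
    rfl

theorem exists_letters (h : IsCertificate k A B C U z) (e : α ≃ Fin k) :
    ∃ z' : List α, z'.map (fun a => (e a : ℕ)) = z :=
  ⟨z.pmap (fun a ha => e.symm ⟨a, ha⟩) h.letters, by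
    rw [List.map_pmap]
    simp⟩

theorem profile_eq (e : α ≃ Fin k) (A : AutomatonCode) (u : List α) :
    (FSMCode.toFSM e A.fsm).profile (FreeMonoid.ofList u) =
      A.fsm.natFSM.profile (FreeMonoid.ofList (u.map fun a => (e a : ℕ))) := by
  rw [FSMCode.profile_toFSM]
  rfl

theorem isLocallyInvertible (h : IsCertificate k A B C U z) (e : α ≃ Fin k) {z' : List α}
    (hz' : z'.map (fun a => (e a : ℕ)) = z) :
    (FSMCode.toFSM e A.fsm).IsLocallyInvertible (FreeMonoid.ofList z') := by
  have hz : (FSMCode.toFSM e A.fsm).profile (FreeMonoid.ofList z') =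
      A.fsm.natFSM.profile (FreeMonoid.ofList z) := by rw [profile_eq, hz']
  constructor
  · have := FSMCode.profileEq_iff.1 h.idem
    rwa [FreeMonoid.ofList_append, map_mul, ← hz] at this
  · intro v
    obtain ⟨i, hi, hv⟩ := h.exists_word e (FreeMonoid.toList v)
    rw [FreeMonoid.ofList_toList] at hv
    obtain ⟨j, -, h₁, h₂⟩ := h.inv i hi
    rw [FSMCode.profileEq_iff] at h₁ h₂
    simp only [FreeMonoid.ofList_append, map_mul, ← hz, ← hv] at h₁ h₂
    exact ⟨_, h₁, h₂⟩

/-- The automaton `B` accepts the words with a prefix that decides for acceptance. -/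
theorem mem_language_open_iff (h : IsCertificate k A B C U z) (e : α ≃ Fin k) {z' : List α}
    (hz' : z'.map (fun a => (e a : ℕ)) = z) (x : ℕ → α) :
    x ∈ B.language e ↔ ∃ n,
      (FSMCode.toFSM e A.fsm).profile (factor x 0 n) *
          (FSMCode.toFSM e A.fsm).profile (FreeMonoid.ofList z') =
        (FSMCode.toFSM e A.fsm).profile (factor x 0 n) ∧
      (FSMCode.toFSM e A.fsm).Accepting A.family
        ((FSMCode.toFSM e A.fsm).profile (factor x 0 n))
        ((FSMCode.toFSM e A.fsm).profile (FreeMonoid.ofList z')) := by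
  set M := FSMCode.toFSM e A.fsm with hM
  have hz : M.profile (FreeMonoid.ofList z') = A.fsm.natFSM.profile (FreeMonoid.ofList z) := by
    rw [profile_eq, hz']
  have hfinal : ∀ n i, i < B.1.1 + 1 → M.profile (factor x 0 n) =
      A.fsm.natFSM.profile (FreeMonoid.ofList (U.getD i [])) → (i ∈ B.2 ↔
        M.profile (factor x 0 n) * M.profile (FreeMonoid.ofList z') = M.profile (factor x 0 n) ∧
        M.Accepting A.family (M.profile (factor x 0 n)) (M.profile (FreeMonoid.ofList z'))) := by
    intro n i hi heq
    rw [h.open_final i hi, FSMCode.profileEq_iff, AutomatonCode.acceptsLoop_iff,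
      FreeMonoid.ofList_append, map_mul, ← heq, ← hz]
    rfl
  have hsucc : ∀ t i, M.profile (factor x 0 t) =
      A.fsm.natFSM.profile (FreeMonoid.ofList (U.getD i [])) → M.profile (factor x 0 (t + 1)) =
      A.fsm.natFSM.profile (FreeMonoid.ofList (U.getD i [] ++ [(e (x t) : ℕ)])) := by
    intro t i hi
    rw [factor_succ x (Nat.zero_le t), map_mul, hi, FreeMonoid.ofList_append, map_mul]
    rfl
  constructor
  · rintro ⟨r, ⟨hr0, hr⟩, q, hq, hqF⟩
    have hex : ∃ t, (r t : ℕ) ∈ B.2 := by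
      obtain ⟨t, ht⟩ := hq.nonempty
      exact ⟨t, by rw [show r t = q from ht]; exact hqF⟩
    classical
    -- up to the first visit to a final state the run follows the profile of the prefix
    have hfollow : ∀ t ≤ Nat.find hex, M.profile (factor x 0 t) =
        A.fsm.natFSM.profile (FreeMonoid.ofList (U.getD (r t) [])) := by
      intro t ht
      induction t with
      | zero =>
        have : (r 0 : ℕ) = 0 := (congrArg Fin.val hr0).trans h.open_start
        rw [this, h.word_zero, factor_self]
        simp
      | succ t ih =>
        have hstep := (h.open_step _ (r t).2 _ (e (x t)).2 _ (r (t + 1)).2).1 (hr t)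
        rcases hstep with hstep | ⟨-, hF⟩
        · rw [hsucc t (r t) (ih (by omega)), FSMCode.profileEq_iff.1 hstep]
        · exact absurd hF (Nat.find_min hex (by omega))
    exact ⟨_, (hfinal _ _ (r _).2 (hfollow _ le_rfl)).1 (Nat.find_spec hex)⟩
  · rintro ⟨n, hn⟩
    obtain ⟨J, hJ0, hJlt, hJ⟩ : ∃ J : ℕ → ℕ, J 0 = 0 ∧ (∀ t, J t < B.1.1 + 1) ∧
        ∀ t, M.profile (factor x 0 t) =
          A.fsm.natFSM.profile (FreeMonoid.ofList (U.getD (J t) [])) := by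
      choose J hJ hJ' using fun t => h.exists_word e (FreeMonoid.toList (factor x 0 t))
      refine ⟨fun t => if t = 0 then 0 else J t, if_pos rfl, fun t => ?_, fun t => ?_⟩
      · dsimp only
        split_ifs
        exacts [Nat.succ_pos _, hJ t]
      · dsimp only
        split_ifs with ht
        · rw [ht, h.word_zero, factor_self]
          simp
        · exact hJ' t
    have hJn := (hfinal n (J n) (hJlt n) (hJ n)).2 hn
    -- follow the profile of the prefix up to position `n` and stay there
    refine ⟨fun t => ⟨J (min t n), hJlt _⟩, ⟨Fin.ext ?_, fun t => ?_⟩, ⟨J n, hJlt n⟩, ?_, hJn⟩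
    · dsimp only
      rw [Nat.zero_min, hJ0]
      exact h.open_start.symm
    · refine (h.open_step _ (hJlt _) _ (e (x t)).2 _ (hJlt _)).2 ?_
      rcases lt_or_ge t n with ht | ht
      · left
        rw [FSMCode.profileEq_iff, min_eq_left ht.le, min_eq_left (Nat.succ_le_of_lt ht),
          ← hsucc t _ (hJ t)]
        exact hJ (t + 1)
      · right
        rw [min_eq_right ht, min_eq_right (ht.trans t.le_succ)]
        exact ⟨rfl, hJn⟩
    · refine (Set.Ici_infinite n).mono fun t ht => Fin.ext ?_
      change J (min t n) = J n
      rw [min_eq_right ht]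

theorem isOpen_language (h : IsCertificate k A B C U z) [TopologicalSpace α]
    [DiscreteTopology α] (e : α ≃ Fin k) : IsOpen (B.language e) := by
  obtain ⟨z', hz'⟩ := h.exists_letters e
  let M := FSMCode.toFSM e A.fsm
  let Decided : FreeMonoid α → Prop := fun u =>
    M.profile u * M.profile (FreeMonoid.ofList z') = M.profile u ∧
      M.Accepting A.family (M.profile u) (M.profile (FreeMonoid.ofList z'))
  have : B.language e = ⋃ n, {x : ℕ → α | Decided (factor x 0 n)} := by
    ext x
    rw [h.mem_language_open_iff e hz', mem_iUnion]
    rfl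
  rw [this]
  exact isOpen_iUnion fun n => isOpen_ofPred_factor Decided n

theorem language_meager_eq (h : IsCertificate k A B C U z) (e : α ≃ Fin k) {z' : List α}
    (hz' : z'.map (fun a => (e a : ℕ)) = z) : C.language e = avoiding (z' ++ z') := by
  have hzz : (z' ++ z').map (fun a => (e a : ℕ)) = z ++ z := by rw [List.map_append, hz']
  refine BuchiAutomaton.language_eq_avoiding (f := fun a => (e a : ℕ))
    (Fin.val_injective.comp e.injective) ?_ (Fin.ext h.meager_start) (fun p => ?_)
    fun p a p' => ?_
  · rw [h.meager_size, ← hzz, List.length_map]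
  · refine (h.meager_final p p.2).trans ?_
    rw [ne_eq, Fin.ext_iff]
    rfl
  · rw [hzz]
    exact h.meager_step p p.2 _ (e a).2 p' p'.2

end IsCertificate

end OmegaAutomata

open OmegaAutomata
theorem mainTheorem1 :
    ∃ B C : ℕ → AutomatonCode → BuchiCode, Computable₂ B ∧ Computable₂ C ∧
      ∀ (α : Type*) [TopologicalSpace α] [DiscreteTopology α] (k : ℕ) (e : α ≃ Fin k)
        (A : AutomatonCode),
        IsOpen (BuchiCode.language e (B k A)) ∧
        IsMeagerFSigma (BuchiCode.language e (C k A)) ∧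
        symmDiff (AutomatonCode.language e A) (BuchiCode.language e (B k A)) ⊆
          BuchiCode.language e (C k A) := by
  have hR : PrimrecRel fun (s : ℕ × AutomatonCode)
      (t : BuchiCode × BuchiCode × List (List ℕ) × List ℕ) =>
        IsCertificate s.1 s.2 t.1 t.2.1 t.2.2.1 t.2.2.2 :=
    primrecPred_isCertificate (Primrec.fst.comp .fst) (Primrec.snd.comp .fst)
      (Primrec.fst.comp .snd) (Primrec.fst.comp (Primrec.snd.comp .snd))
      (Primrec.fst.comp (Primrec.snd.comp (Primrec.snd.comp .snd)))
      (Primrec.snd.comp (Primrec.snd.comp (Primrec.snd.comp .snd)))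
  obtain ⟨f, hf, hcert⟩ := hR.exists_computable fun s => by
    obtain ⟨B, C, U, z, h⟩ := exists_isCertificate s.1 s.2
    exact ⟨(B, C, U, z), h⟩
  refine ⟨fun k A => (f (k, A)).1, fun k A => (f (k, A)).2.1, Computable.fst.comp hf,
    Computable.fst.comp (Computable.snd.comp hf), fun α _ _ k e A => ?_⟩
  have h := hcert (k, A)
  obtain ⟨z', hz'⟩ := h.exists_letters e
  have hopen := h.mem_language_open_iff e hz'
  have hmeager := h.language_meager_eq e hz'
  refine ⟨h.isOpen_language e, hmeager ▸ isMeagerFSigma_avoiding _, fun x hx => ?_⟩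
  · rw [hmeager]
    by_contra hxC
    have hgen : OccursInfinitelyOften (FreeMonoid.ofList z' * FreeMonoid.ofList z') x :=
      occursInfinitelyOften_of_notMem_avoiding hxC
    have hiff : x ∈ AutomatonCode.language e A ↔ x ∈ BuchiCode.language e (f (k, A)).1 := by
      rw [AutomatonCode.mem_language, hopen,
        (h.isLocallyInvertible e hz').exists_run_iff hgen A.family]
    rcases hx with ⟨h₁, h₂⟩ | ⟨h₁, h₂⟩
    · exact h₂ (hiff.1 h₁)
    · exact h₂ (hiff.2 h₁)
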